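/- Let $N$ and $\ell$ be integers with $1<|N|<\ell$, and assume that either $N>0$ and $\ell-N$ is even, or $N<0$ and $N$ is even. Let $q\in\mathbb C$ with $q^2=e^{\pm 2\pi i/\ell}$ (for instance $q=e^{\pi i/\ell}$), and write $[n]=(q^n-q^{-n})/(q-q^{-1})$ for $n\in\mathbb Z$. For a Young diagram $\lambda$ with $\lambda_i$ boxes in the $i$-th row and $\lambda'_j$ boxes in the $j$-th column, let $h(i,j)$ be the hook length of the box $(i,j)$ and put $$d(i,j)=\begin{cases}\lambda_i+\lambda_j-i-j & \text{if } i\le j,\\ -\lambda_i'-\lambda_j'+i+j-2 & \text{if } i>j,\end{cases}\qquad d_\lambda=\prod_{(i,j)\in\lambda}\frac{[N+d(i,j)]}{[h(i,j)]}.$$ Let $\Lambda(N,\ell)$ be the set of Young diagrams $\lambda$ with $\lambda_1'+\lambda_2'\le N$ and $\lambda_1\le(\ell-N)/2$ if $N>0$, and with $\lambda_1\le|N|/2$ and $\lambda_1'+\lambda_2'\le\ell-|N|$ if $N<0$. Let $\Lambda(N,\ell)_{ev}$ be the subset of the diagrams with an even number of boxes; it is finite. Let $k=\lfloor |N|/2\rfloor$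 and $\check\rho=\big((|N|+1)/2-i\big)_{1\le i\le k}\in\mathbb R^k$. Then $$\sum_{\lambda\in\Lambda(N,\ell)_{ev}}d_\lambda^2=\frac{\ell^k}{b(N)}\prod_{\alpha>0}\frac{1}{4\sin^2\big((\alpha,\check\rho)\pi/\ell\big)}.$$ Here $(\cdot,\cdot)$ is the usual scalar product of $\mathbb R^k$, and $\alpha$ runs through the positive roots of $\mathfrak{so}_N$ if $N>0$ and of $\mathfrak{sp}_{|N|}$ if $N<0$. In terms of the standard basis $\phi_1,\dots,\phi_k$ of $\mathbb R^k$ these are the vectors $\phi_i\pm\phi_j$ $(i<j)$, together with all $\phi_i$ if $N=2k+1>0$, and together with all $2\phi_i$ if $N=-2k<0$. Finally $b(N)=2$ if $N>0$ is even, and $b(N)=1$ otherwise. -/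

import Mathlib

namespace SquareSum

/-- The `q`-number `[n] = (q^n - q^{-n}) / (q - q^{-1})`. -/
noncomputable def qNum (q : ℂ) (n : ℤ) : ℂ :=
  (q ^ n - q ^ (-n)) / (q - q⁻¹)

/-- The hook length of the box `c = (i, j)`. Boxes are indexed from `0`, so the arm has
`rowLen i - j - 1` boxes and the leg has `colLen j - i - 1` boxes. -/
def hook (μ : YoungDiagram) (c : ℕ × ℕ) : ℤ :=
  ((μ.rowLen c.1 : ℤ) - c.2 - 1) + ((μ.colLen c.2 : ℤ) - c.1 - 1) + 1

/-- The quantity which in terms of `1`-based indices `i, j` is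
`λ_i + λ_j - i - j` if `i ≤ j`, and `-λ'_i - λ'_j + i + j - 2` if `i > j`.
Here the box `c` is `0`-based, so `i = c.1 + 1` and `j = c.2 + 1`. -/
def dExp (μ : YoungDiagram) (c : ℕ × ℕ) : ℤ :=
  if c.1 ≤ c.2 then
    (μ.rowLen c.1 : ℤ) + μ.rowLen c.2 - (c.1 + 1) - (c.2 + 1)
  else
    -(μ.colLen c.1 : ℤ) - μ.colLen c.2 + (c.1 + 1) + (c.2 + 1) - 2

/-- `d_λ = ∏_{(i,j) ∈ λ} [N + d(i,j)] / [h(i,j)]`. -/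
noncomputable def dWeight (N : ℤ) (q : ℂ) (μ : YoungDiagram) : ℂ :=
  ∏ c ∈ μ.cells, qNum q (N + dExp μ c) / qNum q (hook μ c)

/-- The labelling set `Λ(N, ℓ)`; `rowLen 0`, `rowLen 1` are `λ_1`, `λ_2` and
`colLen 0`, `colLen 1` are `λ'_1`, `λ'_2`. The bounds `λ_1 ≤ (ℓ - N) / 2` and
`λ_1 ≤ |N| / 2` are written without division. -/
def diagrams (N : ℤ) (ℓ : ℕ) : Set YoungDiagram :=
  {μ |
    if 0 < N then
      (μ.colLen 0 : ℤ) + μ.colLen 1 ≤ N ∧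
        (if Even ((ℓ : ℤ) - N) then 2 * (μ.rowLen 0 : ℤ) ≤ ℓ - N
          else (μ.rowLen 0 : ℤ) + μ.rowLen 1 ≤ ℓ - N)
    else
      (if Even N then 2 * (μ.rowLen 0 : ℤ) ≤ |N|
        else (μ.rowLen 0 : ℤ) + μ.rowLen 1 ≤ |N|) ∧
        (μ.colLen 0 : ℤ) + μ.colLen 1 ≤ ℓ - |N|}

/-- `Λ(N, ℓ)_ev`: the diagrams in `Λ(N, ℓ)` with an even number of boxes. -/
def evenDiagrams (N : ℤ) (ℓ : ℕ) : Set YoungDiagram :=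
  {μ | μ ∈ diagrams N ℓ ∧ Even μ.card}

/-- The rank `k`, where `|N| = 2k` or `|N| = 2k + 1`. -/
def rk (N : ℤ) : ℕ := N.natAbs / 2

/-- `b(N) = 2` if `N > 0` is even, and `b(N) = 1` otherwise. -/
def bConst (N : ℤ) : ℕ := if 0 < N ∧ Even N then 2 else 1

/-- The vector `((|N| + 1) / 2 - i)_{1 ≤ i ≤ k}`, with `i` shifted to start from `0`. -/
noncomputable def rhoCheck (N : ℤ) : Fin (rk N) → ℝ :=
  fun i => (|(N : ℝ)| + 1) / 2 - ((i : ℝ) + 1)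

/-- The standard basis vector `φ_i` of `ℝ^k`. -/
def phi {k : ℕ} (i : Fin k) : Fin k → ℝ := Pi.single i 1

/-- The positive roots, in the standard coordinates on `ℝ^k`, of `so_N` if `N > 0` and of
`sp_{|N|}` if `N < 0` is even:
* `φ_i ± φ_j` with `i < j` (type `D_k`) for `so_{2k}`;
* these together with the `φ_i` (type `B_k`) for `so_{2k+1}`;
* these together with the `2 φ_i` (type `C_k`) for `sp_{2k}`. -/
def posRoots (N : ℤ) : Set (Fin (rk N) → ℝ) :=
  {α | (∃ i j, i < j ∧ (α = phi i - phi j ∨ α = phi i + phi j)) ∨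
    (0 < N ∧ Odd N ∧ ∃ i, α = phi i) ∨
    (N < 0 ∧ Even N ∧ ∃ i, α = (2 : ℝ) • phi i)}

end SquareSum

/-! Since `[n]² = sin²(nπ/ℓ) / sin²(π/ℓ)`, the number `d_λ²` is a product of quotients of values of
`g(n) = 4 sin²(nπ/ℓ)`. Adding the boxes of `λ` one at a time, the multiset of the `N + d(i,j)` is
computed from the positions of the rows or columns of `λ` in its Maya diagram, and `d_λ²` becomes a
Weyl-type quotient of root products over a strictly decreasing sequence `p`. The denominator is the
product over the positive roots at `ρ̌`. The numerator is, up to a product over the single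
`p_i`, the square of a Vandermonde determinant in the `2 cos θ_{p_i}`, because
`g(a - b) g(a + b + δ) = (2 cos θ_a - 2 cos θ_b)²` for `θ_x = (2x + δ)π/ℓ`.

The weight `d_λ²` is invariant under `λ'_1 ↦ T - λ'_1`, where `T` bounds `λ'_1 + λ'_2`. For odd `T`
this changes the parity of `λ`, so that the even diagrams contribute as much as all diagrams in a
rectangle. For even `T` it allows restricting to a rectangle, and the parity is detected by an
alternating sum. The sums over a rectangle are sums of squared determinants over strictly decreasing
sequences: Andréief's identity makes them determinants of Gram matrices of cosines, which are
diagonal by discrete orthogonality. -/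

namespace SquareSum

open Finset

/-- The position `λ_i - i` of row `i` (`1`-based) in the Maya diagram of `λ`; here `i` is
`0`-based. Together with the `colBead`s the positions fill `ℤ`. -/
def rowBead (μ : YoungDiagram) (i : ℕ) : ℤ := μ.rowLen i - i - 1

/-- The position `j - 1 - λ'_j` of column `j` (`1`-based) in the Maya diagram of `λ`; here `j` is
`0`-based. -/
def colBead (μ : YoungDiagram) (j : ℕ) : ℤ := j - μ.colLen j

section Beads

variable (μ : YoungDiagram)

lemma lt_rowLen_iff_lt_colLen {i j : ℕ} : j < μ.rowLen i ↔ i < μ.colLen j := by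
  rw [← YoungDiagram.mem_iff_lt_rowLen, YoungDiagram.mem_iff_lt_colLen]

lemma rowLen_eq_zero_iff {i : ℕ} : μ.rowLen i = 0 ↔ μ.colLen 0 ≤ i := by
  have := lt_rowLen_iff_lt_colLen μ (i := i) (j := 0)
  omega

variable {μ} in
lemma rowLen_eq_of_forall {i n : ℕ} (h : ∀ j, (i, j) ∈ μ ↔ j < n) : μ.rowLen i = n := by
  have h₁ := h n
  have h₂ := h (μ.rowLen i)
  rw [YoungDiagram.mem_iff_lt_rowLen] at h₁ h₂
  omega

variable {μ} in
lemma colLen_eq_of_forall {j n : ℕ} (h : ∀ i, (i, j) ∈ μ ↔ i < n) : μ.colLen j = n := by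
  rw [← YoungDiagram.rowLen_transpose]
  exact rowLen_eq_of_forall fun i => by simp [h]

lemma rowBead_ne_colBead (i j : ℕ) : rowBead μ i ≠ colBead μ j := by
  have := lt_rowLen_iff_lt_colLen μ (i := i) (j := j)
  unfold rowBead colBead
  omega

lemma rowBead_strictAnti : StrictAnti (rowBead μ) := by
  intro i j hij
  have := μ.rowLen_anti i j hij.le
  unfold rowBead
  omega

lemma colBead_strictMono : StrictMono (colBead μ) := by
  intro i j hij
  have := μ.colLen_anti i j hij.le
  unfold colBead
  omega

lemma dExp_eq (i j : ℕ) :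
    dExp μ (i, j) =
      if i ≤ j then rowBead μ i + rowBead μ j else colBead μ i + colBead μ j := by
  unfold dExp rowBead colBead
  split_ifs <;> ring

lemma hook_eq (i j : ℕ) : hook μ (i, j) = rowBead μ i - colBead μ j := by
  unfold hook rowBead colBead
  ring

/-- `(r, s)` is a point of the boundary path of `μ`. -/
lemma image_rowBead_union_image_colBead {r s M : ℕ} (hrM : r ≤ M) (hM : μ.colLen 0 ≤ M)
    (hcol : ∀ j < s, r ≤ μ.colLen j) (hrow : μ.rowLen r ≤ s) :
    (Ico r M).image (rowBead μ) ∪ (range s).image (colBead μ) = Ico (-(M : ℤ)) (s - r) := by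
  apply Finset.eq_of_subset_of_card_le
  · refine union_subset (image_subset_iff.2 fun i hi => ?_) (image_subset_iff.2 fun j hj => ?_)
    · have := μ.rowLen_anti r i (mem_Ico.1 hi).1
      simp only [rowBead, mem_Ico] at hi ⊢
      omega
    · have := hcol j (mem_range.1 hj)
      have := μ.colLen_anti 0 j (Nat.zero_le _)
      simp only [colBead, mem_Ico, mem_range] at hj ⊢
      omega
  · have hdisj : Disjoint ((Ico r M).image (rowBead μ)) ((range s).image (colBead μ)) := by
      simp only [disjoint_left, mem_image, not_exists, not_and]
      rintro _ ⟨i, -, rfl⟩ j -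
      exact (rowBead_ne_colBead μ i j).symm
    rw [card_union_of_disjoint hdisj, card_image_of_injective _ (rowBead_strictAnti μ).injective,
      card_image_of_injective _ (colBead_strictMono μ).injective, Int.card_Ico, Nat.card_Ico,
      card_range]
    omega

lemma sum_rowBead_add_sum_colBead {A : Type*} [AddCommMonoid A] {r s M : ℕ} (hrM : r ≤ M)
    (hM : μ.colLen 0 ≤ M) (hcol : ∀ j < s, r ≤ μ.colLen j) (hrow : μ.rowLen r ≤ s) (f : ℤ → A) :
    ∑ i ∈ Ico r M, f (rowBead μ i) + ∑ j ∈ range s, f (colBead μ j) =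
      ∑ u ∈ Ico (-(M : ℤ)) (s - r), f u := by
  rw [← image_rowBead_union_image_colBead μ hrM hM hcol hrow, sum_union,
    sum_image (rowBead_strictAnti μ).injective.injOn,
    sum_image (colBead_strictMono μ).injective.injOn]
  simp only [disjoint_left, mem_image, not_exists, not_and]
  rintro _ ⟨i, -, rfl⟩ j -
  exact (rowBead_ne_colBead μ i j).symm

lemma sum_cells {A : Type*} [AddCommMonoid A] {M : ℕ} (hM : μ.colLen 0 ≤ M) (F : ℕ × ℕ → A) :
    ∑ c ∈ μ.cells, F c = ∑ i ∈ range M, ∑ j ∈ range (μ.rowLen i), F (i, j) := by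
  rw [Finset.sum_finset_product μ.cells (range M) (fun i => range (μ.rowLen i))]
  rintro ⟨i, j⟩
  have := lt_rowLen_iff_lt_colLen μ (i := i) (j := j)
  have := μ.colLen_anti 0 j (Nat.zero_le _)
  rw [YoungDiagram.mem_cells, YoungDiagram.mem_iff_lt_rowLen, mem_range, mem_range]
  dsimp only
  omega

lemma sum_hook {A : Type*} [AddCommMonoid A] {M : ℕ} (hM : μ.colLen 0 ≤ M) (f : ℤ → A) :
    ∑ c ∈ μ.cells, f (hook μ c) +
        ∑ i ∈ range M, ∑ l ∈ Ico (i + 1) M, f (rowBead μ i - rowBead μ l) =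
      ∑ i ∈ range M, ∑ u ∈ range (μ.rowLen i + (M - 1 - i)), f (u + 1) := by
  rw [sum_cells μ hM, ← sum_add_distrib]
  refine sum_congr rfl fun i hi => ?_
  rw [mem_range] at hi
  simp only [hook_eq]
  rw [add_comm, sum_rowBead_add_sum_colBead μ (r := i + 1) (s := μ.rowLen i) hi hM
    (fun j hj => (lt_rowLen_iff_lt_colLen μ).1 hj) (μ.rowLen_anti i (i + 1) (Nat.le_succ i))
    (fun u => f (rowBead μ i - u))]
  refine sum_nbij' (fun u => (rowBead μ i - u - 1).toNat) (fun u => rowBead μ i - u - 1)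
    ?_ ?_ ?_ ?_ ?_ <;> simp only [mem_Ico, mem_range, rowBead] <;> intro u hu
  on_goal 5 => congr 1
  all_goals omega

end Beads

lemma sum_Ico_int_sub {A : Type*} [AddCommGroup A] (F : ℤ → A) {a b : ℤ} (h : a ≤ b) :
    ∑ u ∈ Ico a b, (F (u + 1) - F u) = F b - F a := by
  induction b, h using Int.leInduction with
  | base => simp
  | succ n hn ih =>
    rw [← Finset.insert_Ico_right_eq_Ico_add_one hn, sum_insert (by simp), ih]
    abel

/-- The change of `f (x - 1 + y)` when `x - 1` is replaced by `x`. Adding a box to a diagram moves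
one row position from `x - 1` to `x`, and one column position from `x` to `x - 1`. -/
def shiftDiff (f : ℤ → ℤ) (x y : ℤ) : ℤ := f (x + y) - f (x - 1 + y)

lemma sum_shiftDiff_beads (μ : YoungDiagram) {r s M : ℕ} (hrM : r ≤ M) (hM : μ.colLen 0 ≤ M)
    (hcol : ∀ j < s, r ≤ μ.colLen j) (hrow : μ.rowLen r ≤ s) (f : ℤ → ℤ) (x : ℤ) :
    ∑ i ∈ Ico r M, shiftDiff f x (rowBead μ i) + ∑ j ∈ range s, shiftDiff f x (colBead μ j) =
      f (x - 1 + s - r) - f (x - 1 - M) := by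
  rw [sum_rowBead_add_sum_colBead μ hrM hM hcol hrow]
  convert sum_Ico_int_sub (fun u => f (x - 1 + u)) (a := -(M : ℤ)) (b := s - r) (by omega) using 2
  · rw [shiftDiff]
    ring_nf
  all_goals ring_nf

/-- `ν` arises from `μ` by adding the box `(a, b)`. -/
structure AddBox (μ ν : YoungDiagram) (a b : ℕ) : Prop where
  mem_iff : ∀ i j, (i, j) ∈ ν ↔ (i = a ∧ j = b) ∨ (i, j) ∈ μ
  notMem : (a, b) ∉ μ

namespace AddBox

variable {μ ν : YoungDiagram} {a b : ℕ}

lemma transpose (h : AddBox μ ν a b) : AddBox μ.transpose ν.transpose b a where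
  mem_iff i j := by simpa [and_comm] using h.mem_iff j i
  notMem := by simpa using h.notMem

lemma rowLen_left (h : AddBox μ ν a b) : μ.rowLen a = b := by
  have hle := h.notMem
  rw [YoungDiagram.mem_iff_lt_rowLen] at hle
  by_contra hne
  have hmem : (a, μ.rowLen a) ∈ ν :=
    ν.up_left_mem le_rfl (by omega) ((h.mem_iff a b).2 (Or.inl ⟨rfl, rfl⟩))
  rw [h.mem_iff, YoungDiagram.mem_iff_lt_rowLen] at hmem
  omega

lemma colLen_left (h : AddBox μ ν a b) : μ.colLen b = a := by
  simpa using h.transpose.rowLen_left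

lemma rowLen_right (h : AddBox μ ν a b) (i : ℕ) :
    ν.rowLen i = μ.rowLen i + if i = a then 1 else 0 := by
  have hleft := h.rowLen_left
  refine rowLen_eq_of_forall fun j => ?_
  rw [h.mem_iff, YoungDiagram.mem_iff_lt_rowLen]
  grind

lemma colLen_right (h : AddBox μ ν a b) (j : ℕ) :
    ν.colLen j = μ.colLen j + if j = b then 1 else 0 := by
  simpa using h.transpose.rowLen_right j

lemma lt_colLen (h : AddBox μ ν a b) : a < ν.colLen 0 := by
  rw [← lt_rowLen_iff_lt_colLen, h.rowLen_right, if_pos rfl]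
  omega

lemma lt_rowLen (h : AddBox μ ν a b) : b < ν.rowLen 0 := by
  simpa using h.transpose.lt_colLen

lemma colLen_le (h : AddBox μ ν a b) (j : ℕ) : μ.colLen j ≤ ν.colLen j := by
  rw [h.colLen_right]
  omega

lemma rowLen_le (h : AddBox μ ν a b) (i : ℕ) : μ.rowLen i ≤ ν.rowLen i := by
  rw [h.rowLen_right]
  omega

lemma rowBead_left (h : AddBox μ ν a b) : rowBead μ a = b - a - 1 := by
  rw [rowBead, h.rowLen_left]

lemma colBead_left (h : AddBox μ ν a b) : colBead μ b = b - a := by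
  rw [colBead, h.colLen_left]

lemma rowBead_right (h : AddBox μ ν a b) (i : ℕ) :
    rowBead ν i = if i = a then (b : ℤ) - a else rowBead μ i := by
  have := h.rowLen_left
  simp only [rowBead, h.rowLen_right]
  grind

lemma colBead_right (h : AddBox μ ν a b) (j : ℕ) :
    colBead ν j = if j = b then (b : ℤ) - a - 1 else colBead μ j := by
  have := h.colLen_left
  simp only [colBead, h.colLen_right]
  grind

lemma sum_cells_right {A : Type*} [AddCommMonoid A] (h : AddBox μ ν a b) (F : ℕ × ℕ → A) :
    ∑ c ∈ ν.cells, F c = F (a, b) + ∑ c ∈ μ.cells, F c := by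
  have hcells : ν.cells = insert (a, b) μ.cells := by
    ext ⟨i, j⟩
    rw [YoungDiagram.mem_cells, h.mem_iff, mem_insert, YoungDiagram.mem_cells, Prod.mk.injEq]
  rw [hcells, sum_insert (by simpa using h.notMem)]

lemma card_right (h : AddBox μ ν a b) : ν.card = μ.card + 1 := by
  have := h.sum_cells_right (fun _ => 1)
  rw [sum_const, sum_const, smul_eq_mul, smul_eq_mul, mul_one, mul_one] at this
  exact this.trans (add_comm _ _)

end AddBox

lemma sum_eq_sum_comp_add_sum_comp {ι κ A : Type*} [AddCommMonoid A] {s : Finset ι}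
    {s₁ s₂ : Finset κ} {e₁ e₂ : κ → ι} {F : ι → A} (maps₁ : ∀ x ∈ s₁, e₁ x ∈ s)
    (maps₂ : ∀ x ∈ s₂, e₂ x ∈ s) (inj₁ : e₁.Injective) (inj₂ : e₂.Injective)
    (disj : ∀ x ∈ s₁, ∀ y ∈ s₂, e₁ x ≠ e₂ y)
    (zero : ∀ c ∈ s, (∀ x ∈ s₁, e₁ x ≠ c) → (∀ x ∈ s₂, e₂ x ≠ c) → F c = 0) :
    ∑ c ∈ s, F c = ∑ x ∈ s₁, F (e₁ x) + ∑ x ∈ s₂, F (e₂ x) := by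
  classical
  rw [← sum_image inj₁.injOn, ← sum_image inj₂.injOn, ← sum_union]
  · refine (sum_subset ?_ fun c hc hnot => zero c hc ?_ ?_).symm <;> grind
  · grind [disjoint_left]

namespace AddBox

variable {μ ν : YoungDiagram} {a b : ℕ}

lemma dExp_right_of_ne (h : AddBox μ ν a b) {i j : ℕ} (ha : i ≤ j → i ≠ a ∧ j ≠ a)
    (hb : j < i → i ≠ b ∧ j ≠ b) : dExp ν (i, j) = dExp μ (i, j) := by
  rw [dExp_eq, dExp_eq]
  split_ifs with hij
  · rw [h.rowBead_right, h.rowBead_right, if_neg (ha hij).1, if_neg (ha hij).2]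
  · have hb := hb (not_le.1 hij)
    rw [h.colBead_right, h.colBead_right, if_neg hb.1, if_neg hb.2]

lemma sum_dExp_sub_of_le (h : AddBox μ ν a b) (hab : a ≤ b) (f : ℤ → ℤ) :
    ∑ c ∈ μ.cells, (f (dExp ν c) - f (dExp μ c)) =
      ∑ i ∈ range b, (f (rowBead ν a + rowBead ν i) - f (rowBead μ a + rowBead μ i)) +
      ∑ j ∈ range (μ.rowLen b),
        (f (colBead ν b + colBead ν j) - f (colBead μ b + colBead μ j)) := by
  have hrow := h.rowLen_left
  have hcol := h.colLen_left
  have hanti := μ.rowLen_anti a b hab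
  rw [sum_eq_sum_comp_add_sum_comp (s₁ := range b) (s₂ := range (μ.rowLen b))
    (e₁ := fun i => (min a i, max a i)) (e₂ := fun j => (b, j))]
  · congr 1 <;> refine sum_congr rfl fun i hi => ?_
    · rcases le_total a i with hi | hi <;>
        simp [dExp_eq, hi, add_comm (rowBead _ i)]
    · rw [mem_range] at hi
      rw [dExp_eq, dExp_eq, if_neg (by omega), if_neg (by omega)]
  · intro i hi
    rw [mem_range] at hi
    rw [YoungDiagram.mem_cells]
    rcases lt_or_ge i a with hia | hia
    · rw [min_eq_right hia.le, max_eq_left hia.le]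
      exact μ.up_left_mem le_rfl hab (YoungDiagram.mem_iff_lt_colLen.2 (by omega))
    · rw [min_eq_left hia, max_eq_right hia, YoungDiagram.mem_iff_lt_rowLen]
      omega
  · exact fun j hj => YoungDiagram.mem_iff_lt_rowLen.2 (mem_range.1 hj)
  · intro x y hxy
    have := Prod.mk.inj hxy
    omega
  · exact fun x y hxy => (Prod.mk.inj hxy).2
  · grind
  · rintro ⟨i, j⟩ hij hA hB
    have hij₁ := YoungDiagram.mem_iff_lt_rowLen.1 hij
    have hij₂ := YoungDiagram.mem_iff_lt_colLen.1 hij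
    have hiA := hA i
    have hjA := hA j
    have hjB := hB j
    simp only [mem_range, ne_eq, Prod.mk.injEq] at hiA hjA hjB
    rw [sub_eq_zero, h.dExp_right_of_ne (by grind) (by grind)]

lemma sum_dExp_sub_of_lt (h : AddBox μ ν a b) (hab : b < a) (f : ℤ → ℤ) :
    ∑ c ∈ μ.cells, (f (dExp ν c) - f (dExp μ c)) =
      ∑ i ∈ range (μ.colLen a),
        (f (rowBead ν a + rowBead ν i) - f (rowBead μ a + rowBead μ i)) +
      ∑ j ∈ (range a).erase b,
        (f (colBead ν b + colBead ν j) - f (colBead μ b + colBead μ j)) := by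
  have hrow := h.rowLen_left
  have hcol := h.colLen_left
  have hanti := μ.colLen_anti b a hab.le
  rw [sum_eq_sum_comp_add_sum_comp (s₁ := range (μ.colLen a)) (s₂ := (range a).erase b)
    (e₁ := fun i => (i, a)) (e₂ := fun j => (max b j, min b j))]
  · congr 1 <;> refine sum_congr rfl fun i hi => ?_
    · rw [mem_range] at hi
      rw [dExp_eq, dExp_eq, if_pos (by omega), if_pos (by omega), add_comm,
        add_comm (rowBead μ i)]
    · rw [mem_erase] at hi
      rw [dExp_eq, dExp_eq, if_neg (by omega), if_neg (by omega)]
      rcases le_total b i with hi | hi <;> simp [hi, add_comm (colBead _ i)]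
  · exact fun j hj => YoungDiagram.mem_iff_lt_colLen.2 (mem_range.1 hj)
  · intro i hi
    rw [mem_erase, mem_range] at hi
    rw [YoungDiagram.mem_cells]
    rcases lt_or_ge i b with hib | hib
    · rw [min_eq_right hib.le, max_eq_left hib.le]
      exact μ.up_left_mem le_rfl hib.le (YoungDiagram.mem_iff_lt_colLen.2 (by omega))
    · rw [min_eq_left hib, max_eq_right hib, YoungDiagram.mem_iff_lt_colLen]
      omega
  · exact fun x y hxy => (Prod.mk.inj hxy).1
  · intro x y hxy
    have := Prod.mk.inj hxy
    omega
  · grind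
  · rintro ⟨i, j⟩ hij hA hB
    have hij₁ := YoungDiagram.mem_iff_lt_rowLen.1 hij
    have hij₂ := YoungDiagram.mem_iff_lt_colLen.1 hij
    have hiA := hA i
    have hiB := hB i
    have hjB := hB j
    simp only [mem_range, mem_erase, ne_eq, Prod.mk.injEq] at hiA hiB hjB
    rw [sub_eq_zero, h.dExp_right_of_ne (by grind) (by grind)]

lemma apply_rowBead_right_sub (h : AddBox μ ν a b) (f : ℤ → ℤ) (i : ℕ) :
    f (rowBead ν a + rowBead ν i) - f (rowBead μ a + rowBead μ i) =
      shiftDiff f (b - a) (rowBead μ i) +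
        if i = a then f (2 * (b - a)) - f (2 * (b - a) - 1) else 0 := by
  rw [h.rowBead_right, h.rowBead_right, if_pos rfl, h.rowBead_left, shiftDiff]
  split_ifs with hi
  · rw [hi, h.rowBead_left]
    ring_nf
  · ring_nf

lemma apply_colBead_right_sub (h : AddBox μ ν a b) (f : ℤ → ℤ) {j : ℕ} (hj : j ≠ b) :
    f (colBead ν b + colBead ν j) - f (colBead μ b + colBead μ j) =
      -shiftDiff f (b - a) (colBead μ j) := by
  rw [h.colBead_right, h.colBead_right, if_pos rfl, if_neg hj, h.colBead_left, shiftDiff]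
  ring

lemma sum_dExp_right (h : AddBox μ ν a b) (f : ℤ → ℤ) :
    ∑ c ∈ ν.cells, f (dExp ν c) = f (dExp ν (a, b)) + ∑ c ∈ μ.cells, f (dExp μ c) +
      ∑ c ∈ μ.cells, (f (dExp ν c) - f (dExp μ c)) := by
  rw [h.sum_cells_right, sum_sub_distrib]
  ring

lemma sum_dExp_right_of_le (h : AddBox μ ν a b) (hab : a ≤ b) {M : ℕ} (hM : ν.colLen 0 ≤ M)
    (hbM : b ≤ M) (f : ℤ → ℤ) :
    ∑ c ∈ ν.cells, f (dExp ν c) = ∑ c ∈ μ.cells, f (dExp μ c) + f (b - a - 1 - M) +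
      (f (2 * (b - a)) - f (2 * (b - a) - 1)) +
      ∑ i ∈ range M, shiftDiff f (b - a) (rowBead μ i) := by
  have hb : μ.rowLen b ≤ b := h.rowLen_left ▸ μ.rowLen_anti a b hab
  have htail := sum_shiftDiff_beads μ hbM ((h.colLen_le 0).trans hM)
    (fun j hj => ((lt_rowLen_iff_lt_colLen μ).1 hj).le) le_rfl f (b - a)
  have hrows := sum_congr rfl fun i (_ : i ∈ range b) => h.apply_rowBead_right_sub f i
  have hcols := sum_congr rfl fun j (hj : j ∈ range (μ.rowLen b)) =>
    h.apply_colBead_right_sub f (j := j) (by grind)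
  rw [h.sum_dExp_right, h.sum_dExp_sub_of_le hab, hrows, hcols, sum_neg_distrib, sum_add_distrib,
    sum_ite_eq', ← sum_range_add_sum_Ico _ hbM, dExp_eq, if_pos hab, h.rowBead_right,
    h.rowBead_right, if_pos rfl]
  rcases hab.lt_or_eq with hlt | rfl
  · rw [if_neg hlt.ne', if_pos (mem_range.2 hlt),
      show (b : ℤ) - a + rowBead μ b = b - a - 1 + μ.rowLen b - b by rw [rowBead]; ring]
    linarith
  · rw [if_pos rfl, if_neg (by simp)]
    rw [h.rowLen_left] at htail ⊢
    ring_nf at htail ⊢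
    linarith

lemma sum_dExp_right_of_lt (h : AddBox μ ν a b) (hab : b < a) {M : ℕ} (hM : ν.colLen 0 ≤ M)
    (f : ℤ → ℤ) :
    ∑ c ∈ ν.cells, f (dExp ν c) = ∑ c ∈ μ.cells, f (dExp μ c) + f (b - a - 1 - M) +
      (f (2 * (b - a)) - f (2 * (b - a) - 1)) +
      ∑ i ∈ range M, shiftDiff f (b - a) (rowBead μ i) := by
  have ha : μ.colLen a ≤ a := h.colLen_left ▸ μ.colLen_anti b a hab.le
  have haM : μ.colLen a ≤ M := ha.trans (h.lt_colLen.le.trans hM)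
  have htail := sum_shiftDiff_beads μ haM ((h.colLen_le 0).trans hM)
    (fun j hj => μ.colLen_anti j a hj.le)
    (not_lt.1 fun hlt => ((lt_rowLen_iff_lt_colLen μ).1 hlt).false) f (b - a)
  have hrows := sum_congr rfl fun i (_ : i ∈ range (μ.colLen a)) => h.apply_rowBead_right_sub f i
  have hcols := sum_congr rfl fun j (hj : j ∈ (range a).erase b) =>
    h.apply_colBead_right_sub f (ne_of_mem_erase hj)
  rw [← add_sum_erase _ _ (mem_range.2 hab), h.colBead_left, shiftDiff] at htail
  rw [h.sum_dExp_right, h.sum_dExp_sub_of_lt hab, hrows, hcols, sum_neg_distrib, sum_add_distrib,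
    sum_ite_eq', if_neg (by simpa using ha), ← sum_range_add_sum_Ico _ haM, dExp_eq,
    if_neg (not_le.2 hab), h.colBead_right, h.colBead_right, if_pos rfl, if_neg hab.ne',
    show colBead μ a + (b - a - 1) = (b : ℤ) - a - 1 + a - μ.colLen a by rw [colBead]; ring]
  ring_nf at htail ⊢
  linarith

lemma sum_dExp_right_col (h : AddBox μ ν a b) {L : ℕ} (hL : ν.rowLen 0 ≤ L) (f : ℤ → ℤ) :
    ∑ c ∈ ν.cells, f (dExp ν c) = ∑ c ∈ μ.cells, f (dExp μ c) + f (b - a - 1 + L) +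
      (f (2 * (b - a)) - f (2 * (b - a) - 1)) -
      ∑ j ∈ range L, shiftDiff f (b - a) (colBead μ j) := by
  obtain ⟨M, hM, hbM⟩ : ∃ M, ν.colLen 0 ≤ M ∧ b ≤ M := ⟨ν.colLen 0 + b, by simp, by simp⟩
  have hbeads := sum_shiftDiff_beads μ (Nat.zero_le M) ((h.colLen_le 0).trans hM)
    (fun _ _ => Nat.zero_le _) ((h.rowLen_le 0).trans hL) f (b - a)
  have hrow := (le_or_gt a b).elim (fun hab => h.sum_dExp_right_of_le hab hM hbM f)
    fun hab => h.sum_dExp_right_of_lt hab hM f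
  rw [Nat.Ico_zero_eq_range, Nat.cast_zero, sub_zero] at hbeads
  linarith

lemma sum_dExp_right_row (h : AddBox μ ν a b) {M : ℕ} (hM : ν.colLen 0 ≤ M) (f : ℤ → ℤ) :
    ∑ c ∈ ν.cells, f (dExp ν c) = ∑ c ∈ μ.cells, f (dExp μ c) + f (b - a - 1 - M) +
      (f (2 * (b - a)) - f (2 * (b - a) - 1)) +
      ∑ i ∈ range M, shiftDiff f (b - a) (rowBead μ i) := by
  have hbeads := sum_shiftDiff_beads μ (Nat.zero_le M) ((h.colLen_le 0).trans hM)
    (fun _ _ => Nat.zero_le _) (h.rowLen_le 0) f (b - a)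
  have hcol := h.sum_dExp_right_col le_rfl f
  rw [Nat.Ico_zero_eq_range, Nat.cast_zero, sub_zero] at hbeads
  linarith

end AddBox

lemma rowLen_bot (i : ℕ) : (⊥ : YoungDiagram).rowLen i = 0 :=
  rowLen_eq_of_forall fun j => by simp

lemma colLen_bot (j : ℕ) : (⊥ : YoungDiagram).colLen j = 0 :=
  colLen_eq_of_forall fun i => by simp

lemma exists_addBox {ν : YoungDiagram} (hν : ν.cells.Nonempty) : ∃ μ a b, AddBox μ ν a b := by
  obtain ⟨c, hc, hmax⟩ := ν.cells.exists_maximal hν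
  refine ⟨⟨ν.cells.erase c, ?_⟩, c.1, c.2, ⟨fun i j => ?_, ?_⟩⟩
  · intro x y hyx hx
    rw [mem_coe, mem_erase] at hx ⊢
    refine ⟨?_, ν.isLowerSet hyx hx.2⟩
    rintro rfl
    exact hx.1 (le_antisymm (hmax hx.2 hyx) hyx)
  · rw [← YoungDiagram.mem_cells, ← YoungDiagram.mem_cells, mem_erase]
    grind
  · rw [← YoungDiagram.mem_cells]
    simp

@[elab_as_elim]
lemma addBox_induction {P : YoungDiagram → Prop} (bot : P ⊥)
    (addBox : ∀ μ ν a b, AddBox μ ν a b → P μ → P ν) (ν : YoungDiagram) : P ν := by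
  induction hn : ν.card generalizing ν with
  | zero =>
    rwa [show ν = ⊥ from YoungDiagram.ext (card_eq_zero.1 hn)]
  | succ n ih =>
    obtain ⟨μ, a, b, h⟩ := exists_addBox (card_pos.1 (hn ▸ n.succ_pos : 0 < ν.card))
    exact addBox μ ν a b h (ih μ (Nat.succ_injective (h.card_right.symm.trans hn)))

section PairSums

variable {M a : ℕ} {x y : ℕ → ℤ}

lemma sum_range_of_eqOn_ne (ha : a < M) (hxy : ∀ i, i ≠ a → y i = x i) (F : ℤ → ℤ) :
    ∑ i ∈ range M, F (y i) = ∑ i ∈ range M, F (x i) + F (y a) - F (x a) := by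
  rw [← add_sum_erase _ _ (mem_range.2 ha), ← add_sum_erase (range M) (fun i => F (x i))
    (mem_range.2 ha), sum_congr rfl fun i hi => by rw [hxy i (ne_of_mem_erase hi)]]
  ring

lemma sum_pairs_succ {A : Type*} [AddCommMonoid A] (F : ℕ → ℕ → A) (M : ℕ) :
    ∑ i ∈ range (M + 1), ∑ j ∈ Ico (i + 1) (M + 1), F i j =
      ∑ i ∈ range M, ∑ j ∈ Ico (i + 1) M, F i j + ∑ i ∈ range M, F i M := by
  rw [sum_range_succ, Ico_self, sum_empty, add_zero, ← sum_add_distrib]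
  exact sum_congr rfl fun i hi => sum_Ico_succ_top (mem_range.1 hi) _

lemma sum_pairs_eq_add_diag {A : Type*} [AddCommMonoid A] (F : ℕ → ℕ → A) (M : ℕ) :
    ∑ i ∈ range M, ∑ j ∈ Ico i M, F i j =
      ∑ i ∈ range M, F i i + ∑ i ∈ range M, ∑ j ∈ Ico (i + 1) M, F i j := by
  rw [← sum_add_distrib]
  exact sum_congr rfl fun i hi => sum_eq_sum_Ico_succ_bot (mem_range.1 hi) _

lemma sum_pairs_of_eqOn_ne (ha : a < M) (hxy : ∀ i, i ≠ a → y i = x i) (f : ℤ → ℤ) :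
    ∑ i ∈ range M, ∑ j ∈ Ico (i + 1) M, f (y i + y j) =
      ∑ i ∈ range M, ∑ j ∈ Ico (i + 1) M, f (x i + x j) +
        ∑ i ∈ range M, (f (y a + x i) - f (x a + x i)) - (f (y a + x a) - f (x a + x a)) := by
  induction M with
  | zero => omega
  | succ M ih =>
    rw [sum_pairs_succ, sum_pairs_succ]
    rcases Nat.lt_succ_iff_lt_or_eq.1 ha with ha | rfl
    · rw [ih ha, sum_range_succ, hxy M ha.ne', sum_range_of_eqOn_ne ha hxy fun u => f (u + x M)]
      ring
    · have hpairs : ∑ i ∈ range a, ∑ j ∈ Ico (i + 1) a, f (y i + y j) =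
          ∑ i ∈ range a, ∑ j ∈ Ico (i + 1) a, f (x i + x j) :=
        sum_congr rfl fun i hi => sum_congr rfl fun j hj => by
          rw [hxy i (mem_range.1 hi).ne, hxy j (mem_Ico.1 hj).2.ne]
      have hlast : ∑ i ∈ range a, f (y i + y a) = ∑ i ∈ range a, f (x i + y a) :=
        sum_congr rfl fun i hi => by rw [hxy i (mem_range.1 hi).ne]
      rw [hpairs, hlast, sum_range_succ, sum_sub_distrib]
      simp only [fun i => add_comm (y a) (x i), fun i => add_comm (x a) (x i)]
      ring

end PairSums

lemma sum_range_sum_range_update {M a : ℕ} (ha : a < M) {m n : ℕ → ℕ}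
    (hmn : ∀ i, n i = m i + if i = a then 1 else 0) (F : ℕ → ℕ → ℤ) :
    ∑ i ∈ range M, ∑ t ∈ range (n i), F i t =
      ∑ i ∈ range M, ∑ t ∈ range (m i), F i t + F a (m a) := by
  rw [← sum_ite_eq_of_mem' (range M) a (fun i => F i (m i)) (mem_range.2 ha), ← sum_add_distrib]
  refine sum_congr rfl fun i _ => ?_
  rw [hmn]
  split_ifs
  · exact sum_range_succ _ _
  · simp

lemma sum_dExp (ν : YoungDiagram) {M : ℕ} (hM : ν.colLen 0 ≤ M) (f : ℤ → ℤ) :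
    ∑ c ∈ ν.cells, f (dExp ν c) +
        ∑ i ∈ range M, ∑ j ∈ Ico i M, f (-(i + 1) + -(j + 1)) =
      ∑ i ∈ range M, ∑ j ∈ Ico i M, f (rowBead ν i + rowBead ν j) +
        ∑ i ∈ range M, ∑ t ∈ range (ν.rowLen i), f (t - i - 1 - M) := by
  induction ν using addBox_induction with
  | bot =>
    have hbead (i : ℕ) : rowBead ⊥ i = -(i + 1) := by rw [rowBead, rowLen_bot]; grind
    simp [hbead, rowLen_bot]
  | addBox μ ν a b h ih =>
    have haM := h.lt_colLen.trans_le hM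
    have hne (i : ℕ) (hi : i ≠ a) : rowBead ν i = rowBead μ i := by rw [h.rowBead_right, if_neg hi]
    have hpairs := sum_pairs_of_eqOn_ne haM hne f
    have hdiag := sum_range_of_eqOn_ne haM hne fun u => f (u + u)
    have hrow := sum_range_sum_range_update haM h.rowLen_right fun i t => f (t - i - 1 - M)
    have ih := ih ((h.colLen_le 0).trans hM)
    simp only [sum_pairs_eq_add_diag (fun i j => f (rowBead _ i + rowBead _ j)),
      h.sum_dExp_right_row hM, shiftDiff] at ih ⊢
    rw [h.rowBead_right, if_pos rfl, h.rowBead_left] at hpairs hdiag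
    rw [h.rowLen_left] at hrow
    ring_nf at *
    linarith

lemma sum_dExp_col (ν : YoungDiagram) {L : ℕ} (hL : ν.rowLen 0 ≤ L) (f : ℤ → ℤ) :
    ∑ c ∈ ν.cells, f (dExp ν c) + ∑ i ∈ range L, ∑ j ∈ Ico (i + 1) L, f (i + j) =
      ∑ i ∈ range L, ∑ j ∈ Ico (i + 1) L, f (colBead ν i + colBead ν j) +
        ∑ j ∈ range L, ∑ t ∈ range (ν.colLen j), f (j - t - 1 + L) := by
  induction ν using addBox_induction with
  | bot => simp [colBead, colLen_bot]
  | addBox μ ν a b h ih =>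
    have hbL := h.lt_rowLen.trans_le hL
    have hne (j : ℕ) (hj : j ≠ b) : colBead ν j = colBead μ j := by rw [h.colBead_right, if_neg hj]
    have hpairs := sum_pairs_of_eqOn_ne hbL hne f
    have hcol := sum_range_sum_range_update hbL h.colLen_right fun j t => f (j - t - 1 + L)
    have ih := ih ((h.rowLen_le 0).trans hL)
    simp only [h.sum_dExp_right_col hL, shiftDiff, sum_sub_distrib] at hpairs ⊢
    rw [h.colBead_right, if_pos rfl, h.colBead_left] at hpairs
    rw [h.colLen_left] at hcol
    ring_nf at *
    linarith

/-- The strictly decreasing sequence `λ_i + k - i` (`1`-based) attached to a diagram with at most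
`k` rows; here `i` is `0`-based. -/
def shiftedRow (k : ℕ) (μ : YoungDiagram) (i : ℕ) : ℕ := μ.rowLen i + (k - 1 - i)

lemma shiftedRow_bot (k i : ℕ) : shiftedRow k ⊥ i = k - 1 - i := by
  rw [shiftedRow, rowLen_bot, zero_add]

lemma rowBead_add {k i : ℕ} (hi : i < k) (μ : YoungDiagram) :
    rowBead μ i + k = shiftedRow k μ i := by
  rw [rowBead, shiftedRow]
  omega

lemma colBead_eq_sub_shiftedRow {k j : ℕ} (hj : j < k) (μ : YoungDiagram) :
    colBead μ j = k - 1 - shiftedRow k μ.transpose j := by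
  rw [colBead, shiftedRow, YoungDiagram.rowLen_transpose]
  omega

section Shifted

variable {k : ℕ} (μ : YoungDiagram) (f : ℤ → ℤ)

lemma sum_hook_shiftedRow (hk : μ.colLen 0 ≤ k) :
    ∑ c ∈ μ.cells, f (hook μ c) + ∑ i ∈ range k, ∑ j ∈ Ico (i + 1) k,
        f (shiftedRow k μ i - shiftedRow k μ j) =
      ∑ i ∈ range k, ∑ u ∈ range (shiftedRow k μ i), f (u + 1) := by
  refine Eq.trans ?_ (sum_hook μ hk f)
  congr 1
  refine sum_congr rfl fun i hi => sum_congr rfl fun j hj => ?_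
  rw [← rowBead_add (mem_range.1 hi), ← rowBead_add (mem_Ico.1 hj).2, add_sub_add_right_eq_sub]

lemma sum_staircase_sub :
    ∑ i ∈ range k, ∑ j ∈ Ico (i + 1) k, f ((k - 1 - i : ℕ) - (k - 1 - j : ℕ)) =
      ∑ i ∈ range k, ∑ u ∈ range (k - 1 - i), f (u + 1) := by
  have h := sum_hook_shiftedRow ⊥ f (k := k) (by rw [colLen_bot]; exact k.zero_le)
  simpa only [shiftedRow_bot, YoungDiagram.cells_bot, sum_empty, zero_add] using h

lemma sum_range_staircase_add (F : ℕ → ℤ) (i : ℕ) :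
    ∑ t ∈ range (μ.rowLen i), F ((k - 1 - i) + t) =
      ∑ u ∈ range (shiftedRow k μ i), F u - ∑ u ∈ range (k - 1 - i), F u := by
  rw [shiftedRow, add_comm, sum_range_add]
  ring

lemma sum_dExp_shiftedRow (hk : μ.colLen 0 ≤ k) (ε : ℤ) :
    ∑ c ∈ μ.cells, f (2 * k + ε + dExp μ c) +
        (∑ i ∈ range k, ∑ j ∈ Ico i k, f ((k - 1 - i : ℕ) + (k - 1 - j : ℕ) + ε) +
          ∑ i ∈ range k, ∑ u ∈ range (k - 1 - i), f (u + ε)) =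
      ∑ i ∈ range k, ∑ j ∈ Ico i k, f (shiftedRow k μ i + shiftedRow k μ j + ε) +
        ∑ i ∈ range k, ∑ u ∈ range (shiftedRow k μ i), f (u + ε) := by
  have h := sum_dExp μ hk fun n => f (2 * k + ε + n)
  have hrow : ∑ i ∈ range k, ∑ t ∈ range (μ.rowLen i), f (2 * k + ε + (t - i - 1 - k)) =
      ∑ i ∈ range k, ∑ u ∈ range (shiftedRow k μ i), f (u + ε) -
        ∑ i ∈ range k, ∑ u ∈ range (k - 1 - i), f (u + ε) := by
    rw [← sum_sub_distrib]
    refine sum_congr rfl fun i hi => ?_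
    rw [← sum_range_staircase_add μ fun u => f (u + ε)]
    refine sum_congr rfl fun t _ => congrArg f ?_
    rw [mem_range] at hi
    omega
  have hbot : ∑ i ∈ range k, ∑ j ∈ Ico i k, f (2 * k + ε + (-(i + 1) + -(j + 1))) =
      ∑ i ∈ range k, ∑ j ∈ Ico i k, f ((k - 1 - i : ℕ) + (k - 1 - j : ℕ) + ε) :=
    sum_congr rfl fun i hi => sum_congr rfl fun j hj => congrArg f <| by
      rw [mem_range] at hi
      rw [mem_Ico] at hj
      omega
  have hbead : ∑ i ∈ range k, ∑ j ∈ Ico i k, f (2 * k + ε + (rowBead μ i + rowBead μ j)) =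
      ∑ i ∈ range k, ∑ j ∈ Ico i k, f (shiftedRow k μ i + shiftedRow k μ j + ε) :=
    sum_congr rfl fun i hi => sum_congr rfl fun j hj => congrArg f <| by
      rw [← rowBead_add (mem_range.1 hi), ← rowBead_add (mem_Ico.1 hj).2]
      ring
  linarith

lemma sum_dExp_shiftedRow_transpose (hk : μ.rowLen 0 ≤ k) (hf : ∀ n, f (-n) = f n) :
    ∑ c ∈ μ.cells, f (-(2 * k) + dExp μ c) +
        (∑ i ∈ range k, ∑ j ∈ Ico (i + 1) k, f ((k - 1 - i : ℕ) + (k - 1 - j : ℕ) + 2) +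
          ∑ i ∈ range k, ∑ u ∈ range (k - 1 - i), f (u + 2)) =
      ∑ i ∈ range k, ∑ j ∈ Ico (i + 1) k,
          f (shiftedRow k μ.transpose i + shiftedRow k μ.transpose j + 2) +
        ∑ i ∈ range k, ∑ u ∈ range (shiftedRow k μ.transpose i), f (u + 2) := by
  have h := sum_dExp_col μ hk fun n => f (-(2 * k) + n)
  have hcol : ∑ j ∈ range k, ∑ t ∈ range (μ.colLen j), f (-(2 * k) + (j - t - 1 + k)) =
      ∑ j ∈ range k, ∑ u ∈ range (shiftedRow k μ.transpose j), f (u + 2) -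
        ∑ j ∈ range k, ∑ u ∈ range (k - 1 - j), f (u + 2) := by
    rw [← sum_sub_distrib]
    refine sum_congr rfl fun j hj => ?_
    rw [← sum_range_staircase_add μ.transpose fun u => f (u + 2), YoungDiagram.rowLen_transpose]
    refine sum_congr rfl fun t _ => ?_
    rw [← hf]
    refine congrArg f ?_
    rw [mem_range] at hj
    omega
  have hbot : ∑ i ∈ range k, ∑ j ∈ Ico (i + 1) k, f (-(2 * k) + (i + j)) =
      ∑ i ∈ range k, ∑ j ∈ Ico (i + 1) k, f ((k - 1 - i : ℕ) + (k - 1 - j : ℕ) + 2) :=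
    sum_congr rfl fun i hi => sum_congr rfl fun j hj => by
      rw [← hf]
      refine congrArg f ?_
      rw [mem_range] at hi
      rw [mem_Ico] at hj
      omega
  have hbead : ∑ i ∈ range k, ∑ j ∈ Ico (i + 1) k, f (-(2 * k) + (colBead μ i + colBead μ j)) =
      ∑ i ∈ range k, ∑ j ∈ Ico (i + 1) k,
          f (shiftedRow k μ.transpose i + shiftedRow k μ.transpose j + 2) :=
    sum_congr rfl fun i hi => sum_congr rfl fun j hj => by
      rw [← hf, colBead_eq_sub_shiftedRow (mem_range.1 hi),
        colBead_eq_sub_shiftedRow (mem_Ico.1 hj).2]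
      ring_nf
  linarith

end Shifted

lemma sum_staircase_add_diag (k : ℕ) (φ : ℕ → ℤ) :
    ∑ i ∈ range k, ∑ j ∈ Ico i k, φ ((k - 1 - i) + (k - 1 - j)) =
      ∑ i ∈ range k, φ (k - 1 - i) +
        ∑ i ∈ range k, ∑ j ∈ Ico (i + 1) k, φ ((k - 1 - i) + (k - 1 - j) + 1) := by
  rw [← sum_add_distrib]
  refine sum_congr rfl fun i hi => ?_
  have hreflect (a : ℕ) (ψ : ℕ → ℤ) :
      ∑ j ∈ Ico a k, ψ (k - 1 - j) = ∑ b ∈ range (k - a), ψ b := by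
    refine sum_nbij' (k - 1 - ·) (k - 1 - ·) ?_ ?_ ?_ ?_ fun _ _ => rfl <;>
      simp only [mem_Ico, mem_range] <;> omega
  rw [mem_range] at hi
  rw [hreflect i fun b => φ (k - 1 - i + b), hreflect (i + 1) fun b => φ (k - 1 - i + b + 1),
    show k - i = k - (i + 1) + 1 by omega, sum_range_succ']
  exact add_comm _ _

lemma sum_range_cast_add_apply (f : ℤ → ℤ) (a : ℤ) (m : ℕ) :
    ∑ u ∈ range m, f (u + a) + f (m + a) = ∑ u ∈ range m, f (u + (a + 1)) + f a := by
  rw [← sum_range_succ (fun u : ℕ => f (u + a)), sum_range_succ']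
  push_cast
  rw [zero_add]
  simp only [add_assoc, add_comm (1 : ℤ)]

section WeylSums

variable {k : ℕ} (μ : YoungDiagram) (f : ℤ → ℤ)

lemma sum_dExp_odd (hk : μ.colLen 0 ≤ k) :
    ∑ c ∈ μ.cells, f (2 * k + 1 + dExp μ c) +
        (∑ i ∈ range k, ∑ j ∈ Ico (i + 1) k, f ((k - 1 - i : ℕ) - (k - 1 - j : ℕ)) +
          ∑ i ∈ range k, ∑ j ∈ Ico (i + 1) k, f ((k - 1 - i : ℕ) + (k - 1 - j : ℕ) + 2) +
          ∑ i ∈ range k, f ((k - 1 - i : ℕ) + 1)) =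
      ∑ c ∈ μ.cells, f (hook μ c) +
        (∑ i ∈ range k, ∑ j ∈ Ico (i + 1) k, f (shiftedRow k μ i - shiftedRow k μ j) +
          ∑ i ∈ range k, ∑ j ∈ Ico (i + 1) k, f (shiftedRow k μ i + shiftedRow k μ j + 1) +
          ∑ i ∈ range k, f (2 * shiftedRow k μ i + 1)) := by
  have hdExp := sum_dExp_shiftedRow μ f hk 1
  have hhook := sum_hook_shiftedRow μ f hk
  have hstair := sum_staircase_add_diag k fun n => f (n + 1)
  rw [sum_pairs_eq_add_diag (fun i j => f (shiftedRow k μ i + shiftedRow k μ j + 1))] at hdExp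
  push_cast at hstair
  simp only [add_assoc, ← two_mul, mul_one] at hdExp hstair ⊢
  linarith [sum_staircase_sub f (k := k)]

lemma sum_dExp_even (hk : μ.colLen 0 ≤ k) :
    ∑ c ∈ μ.cells, f (2 * k + dExp μ c) +
        (∑ i ∈ range k, ∑ j ∈ Ico (i + 1) k, f ((k - 1 - i : ℕ) - (k - 1 - j : ℕ)) +
          ∑ i ∈ range k, ∑ j ∈ Ico (i + 1) k, f ((k - 1 - i : ℕ) + (k - 1 - j : ℕ) + 1) +
          ∑ i ∈ range k, f (shiftedRow k μ i)) =
      ∑ c ∈ μ.cells, f (hook μ c) +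
        (∑ i ∈ range k, ∑ j ∈ Ico (i + 1) k, f (shiftedRow k μ i - shiftedRow k μ j) +
          ∑ i ∈ range k, ∑ j ∈ Ico (i + 1) k, f (shiftedRow k μ i + shiftedRow k μ j) +
          ∑ i ∈ range k, f (2 * shiftedRow k μ i)) := by
  have hdExp := sum_dExp_shiftedRow μ f hk 0
  have hhook := sum_hook_shiftedRow μ f hk
  have hstair := sum_staircase_add_diag k fun n => f n
  have hrow := sum_congr rfl fun i (_ : i ∈ range k) =>
    sum_range_cast_add_apply f 0 (shiftedRow k μ i)
  have hbot := sum_congr rfl fun i (_ : i ∈ range k) => sum_range_cast_add_apply f 0 (k - 1 - i)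
  rw [sum_pairs_eq_add_diag (fun i j => f (shiftedRow k μ i + shiftedRow k μ j + 0))] at hdExp
  push_cast at hstair
  simp only [add_zero, zero_add, ← two_mul, sum_add_distrib] at hdExp hstair hrow hbot ⊢
  linarith [sum_staircase_sub f (k := k)]

lemma sum_hook_transpose : ∑ c ∈ μ.transpose.cells, f (hook μ.transpose c) =
    ∑ c ∈ μ.cells, f (hook μ c) := by
  refine sum_nbij' Prod.swap Prod.swap ?_ ?_ ?_ ?_ ?_ <;> rintro ⟨i, j⟩ hij
  · simpa using hij
  · simpa using hij
  · rfl
  · rfl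
  · simp only [hook, YoungDiagram.rowLen_transpose, YoungDiagram.colLen_transpose, Prod.fst_swap,
      Prod.snd_swap]
    ring_nf

lemma sum_dExp_neg (hk : μ.rowLen 0 ≤ k) (hf : ∀ n, f (-n) = f n) :
    ∑ c ∈ μ.cells, f (-(2 * k) + dExp μ c) +
        (∑ i ∈ range k, ∑ j ∈ Ico (i + 1) k, f ((k - 1 - i : ℕ) - (k - 1 - j : ℕ)) +
          ∑ i ∈ range k, ∑ j ∈ Ico (i + 1) k, f ((k - 1 - i : ℕ) + (k - 1 - j : ℕ) + 1) +
          ∑ i ∈ range k, f (2 * (k - 1 - i : ℕ) + 1)) =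
      ∑ c ∈ μ.cells, f (hook μ c) +
        (∑ i ∈ range k, ∑ j ∈ Ico (i + 1) k,
            f (shiftedRow k μ.transpose i - shiftedRow k μ.transpose j) +
          ∑ i ∈ range k, ∑ j ∈ Ico (i + 1) k,
            f (shiftedRow k μ.transpose i + shiftedRow k μ.transpose j + 2) +
          ∑ i ∈ range k, f (shiftedRow k μ.transpose i + 1)) := by
  have hdExp := sum_dExp_shiftedRow_transpose μ f hk hf
  have hhook := sum_hook_shiftedRow μ.transpose f (by simpa using hk)
  have hstair := sum_staircase_add_diag k fun n => f (n + 1)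
  have hrow := sum_congr rfl fun i (_ : i ∈ range k) =>
    sum_range_cast_add_apply f 1 (shiftedRow k μ.transpose i)
  have hbot := sum_congr rfl fun i (_ : i ∈ range k) => sum_range_cast_add_apply f 1 (k - 1 - i)
  rw [sum_pairs_eq_add_diag] at hstair
  rw [sum_hook_transpose] at hhook
  push_cast at hstair
  simp only [add_assoc, ← two_mul, mul_one, sum_add_distrib] at hdExp hstair hrow hbot ⊢
  linarith [sum_staircase_sub f (k := k)]

end WeylSums

/-- The product of the `g(p_i - p_j) g(p_i + p_j + δ)` over `i < j < k`. For a suitable sequence `p`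
this is the product of `g` over the positive roots of type `D_k`, evaluated at `p + δ / 2`. -/
def pairProd (g : ℤ → ℝ) (k : ℕ) (δ : ℤ) (p : ℕ → ℕ) : ℝ :=
  ∏ i ∈ range k, ∏ j ∈ Ico (i + 1) k, (g (p i - p j) * g (p i + p j + δ))

/-- The product of the `g(N + d(i,j)) / g(h(i,j))` over the boxes; for `g = [·] ^ 2` this is the
square of the weight `d_λ`. -/
noncomputable def gWeight (g : ℤ → ℝ) (N : ℤ) (μ : YoungDiagram) : ℝ :=
  ∏ c ∈ μ.cells, g (N + dExp μ c) / g (hook μ c)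

lemma prod_eq_prod_of_sum_eq_sum {ι κ X R : Type*} [CommMonoid R] {s : Finset ι} {t : Finset κ}
    {u : ι → X} {v : κ → X} (h : ∀ f : X → ℤ, ∑ i ∈ s, f (u i) = ∑ j ∈ t, f (v j)) (g : X → R) :
    ∏ i ∈ s, g (u i) = ∏ j ∈ t, g (v j) := by
  classical
  have hmap : s.val.map u = t.val.map v := by
    ext x
    have hx := h fun y => if x = y then 1 else 0
    rw [sum_boole, sum_boole, Nat.cast_inj] at hx
    rwa [Multiset.count_map, Multiset.count_map]
  have hprod := congrArg (fun m => (m.map g).prod) hmap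
  rwa [Multiset.map_map, Multiset.map_map] at hprod

lemma prod_mul_pairProd_of_sum {k : ℕ} {s : Finset (ℕ × ℕ)} {u v : ℕ × ℕ → ℤ} {p q : ℕ → ℕ}
    {δ ε : ℤ} {S : Finset ℕ} {a b : ℕ → ℤ}
    (h : ∀ f : ℤ → ℤ, (∀ n, f (-n) = f n) →
      ∑ c ∈ s, f (u c) + (∑ i ∈ range k, ∑ j ∈ Ico (i + 1) k, f (p i - p j) +
          ∑ i ∈ range k, ∑ j ∈ Ico (i + 1) k, f (p i + p j + δ) + ∑ i ∈ S, f (a i)) =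
        ∑ c ∈ s, f (v c) + (∑ i ∈ range k, ∑ j ∈ Ico (i + 1) k, f (q i - q j) +
          ∑ i ∈ range k, ∑ j ∈ Ico (i + 1) k, f (q i + q j + ε) + ∑ i ∈ S, f (b i)))
    {g : ℤ → ℝ} (hg : ∀ n, g (-n) = g n) :
    (∏ c ∈ s, g (u c)) * (pairProd g k δ p * ∏ i ∈ S, g (a i)) =
      (∏ c ∈ s, g (v c)) * (pairProd g k ε q * ∏ i ∈ S, g (b i)) := by
  have hgabs (n : ℤ) : g n = g n.natAbs := by
    rcases Int.natAbs_eq n with hn | hn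
    · rw [← hn]
    · rw [hn, hg, Int.natAbs_neg, Int.natAbs_natCast]
  have key := prod_eq_prod_of_sum_eq_sum
    (s := s.disjSum (((range k).sigma fun i => Ico (i + 1) k).disjSum
      (((range k).sigma fun i => Ico (i + 1) k).disjSum S)))
    (t := s.disjSum (((range k).sigma fun i => Ico (i + 1) k).disjSum
      (((range k).sigma fun i => Ico (i + 1) k).disjSum S)))
    (u := Sum.elim (fun c => (u c).natAbs) (Sum.elim (fun x => (p x.1 - p x.2 : ℤ).natAbs)
      (Sum.elim (fun x => (p x.1 + p x.2 + δ : ℤ).natAbs) fun i => (a i).natAbs)))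
    (v := Sum.elim (fun c => (v c).natAbs) (Sum.elim (fun x => (q x.1 - q x.2 : ℤ).natAbs)
      (Sum.elim (fun x => (q x.1 + q x.2 + ε : ℤ).natAbs) fun i => (b i).natAbs)))
    (fun f => by
      simpa only [sum_disjSum, Sum.elim_inl, Sum.elim_inr, sum_sigma, add_assoc] using
        h (fun n => f n.natAbs) fun n => by rw [Int.natAbs_neg])
    (fun n : ℕ => g n)
  simp only [prod_disjSum, Sum.elim_inl, Sum.elim_inr, prod_sigma, ← hgabs] at key
  simpa only [pairProd, prod_mul_distrib, mul_assoc] using key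

section WeylFormulas

variable {g : ℤ → ℝ} {k : ℕ} {μ : YoungDiagram}

lemma gWeight_mul_eq {N : ℤ} {a b : ℝ} (hhook : ∀ c ∈ μ.cells, g (hook μ c) ≠ 0)
    (h : (∏ c ∈ μ.cells, g (N + dExp μ c)) * a = (∏ c ∈ μ.cells, g (hook μ c)) * b) :
    gWeight g N μ * a = b := by
  rw [gWeight, prod_div_distrib, div_mul_eq_mul_div, h, mul_div_cancel_left₀]
  exact prod_ne_zero_iff.2 hhook

lemma gWeight_odd (hg : ∀ n, g (-n) = g n) (hhook : ∀ c ∈ μ.cells, g (hook μ c) ≠ 0)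
    (hk : μ.colLen 0 ≤ k) :
    gWeight g (2 * k + 1) μ *
        (pairProd g k 2 (k - 1 - ·) * ∏ i ∈ range k, g ((k - 1 - i : ℕ) + 1)) =
      pairProd g k 1 (shiftedRow k μ) * ∏ i ∈ range k, g (2 * shiftedRow k μ i + 1) :=
  gWeight_mul_eq hhook (prod_mul_pairProd_of_sum (fun f _ => sum_dExp_odd μ f hk) hg)

lemma gWeight_even (hg : ∀ n, g (-n) = g n) (hhook : ∀ c ∈ μ.cells, g (hook μ c) ≠ 0)
    (hk : μ.colLen 0 ≤ k) :
    gWeight g (2 * k) μ *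
        (pairProd g k 1 (k - 1 - ·) *
          ∏ i ∈ range k with shiftedRow k μ i ≠ 0, g (shiftedRow k μ i)) =
      pairProd g k 0 (shiftedRow k μ) *
        ∏ i ∈ range k with shiftedRow k μ i ≠ 0, g (2 * shiftedRow k μ i) := by
  refine gWeight_mul_eq hhook (prod_mul_pairProd_of_sum (fun f _ => ?_) hg)
  have h := sum_dExp_even μ f hk
  have hzero : ∑ i ∈ range k with ¬shiftedRow k μ i ≠ 0, f (shiftedRow k μ i) =
      ∑ i ∈ range k with ¬shiftedRow k μ i ≠ 0, f (2 * shiftedRow k μ i) :=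
    sum_congr rfl fun i hi => by rw [not_not.1 (mem_filter.1 hi).2, Nat.cast_zero, mul_zero]
  have hsplit := fun F : ℕ → ℤ =>
    sum_filter_add_sum_filter_not (range k) (fun i => shiftedRow k μ i ≠ 0) F
  simp only [add_zero]
  linarith [hsplit fun i => f (shiftedRow k μ i), hsplit fun i => f (2 * shiftedRow k μ i)]

lemma gWeight_neg (hg : ∀ n, g (-n) = g n) (hhook : ∀ c ∈ μ.cells, g (hook μ c) ≠ 0)
    (hk : μ.rowLen 0 ≤ k) :
    gWeight g (-(2 * k)) μ *
        (pairProd g k 1 (k - 1 - ·) * ∏ i ∈ range k, g (2 * (k - 1 - i : ℕ) + 1)) =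
      pairProd g k 2 (shiftedRow k μ.transpose) *
        ∏ i ∈ range k, g (shiftedRow k μ.transpose i + 1) :=
  gWeight_mul_eq hhook (prod_mul_pairProd_of_sum (fun f hf => sum_dExp_neg μ f hk hf) hg)

end WeylFormulas

lemma sum_pairs_succ' {A : Type*} [AddCommMonoid A] (F : ℕ → ℕ → A) (L : ℕ) :
    ∑ i ∈ range (L + 1), ∑ j ∈ Ico (i + 1) (L + 1), F i j =
      ∑ j ∈ range L, F 0 (j + 1) +
        ∑ i ∈ range L, ∑ j ∈ Ico (i + 1) L, F (i + 1) (j + 1) := by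
  rw [sum_range_succ', add_comm, range_eq_Ico, sum_Ico_add' (fun j => F 0 j)]
  congr 1
  exact sum_congr rfl fun i _ => (sum_Ico_add' (fun j => F (i + 1) j) (i + 1) L 1).symm

lemma sum_hook_colBead (μ : YoungDiagram) {L : ℕ} (hL : μ.rowLen 0 ≤ L) (f : ℤ → ℤ) :
    ∑ c ∈ μ.cells, f (hook μ c) +
        ∑ i ∈ range L, ∑ j ∈ Ico (i + 1) L, f (colBead μ j - colBead μ i) =
      ∑ j ∈ range L, ∑ u ∈ range (μ.colLen j + (L - 1 - j)), f (u + 1) := by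
  have h := sum_hook μ.transpose (M := L) (by simpa using hL) f
  simp only [sum_hook_transpose, YoungDiagram.rowLen_transpose] at h
  rw [← h]
  congr 1
  refine sum_congr rfl fun i _ => sum_congr rfl fun j _ => congrArg f ?_
  simp only [rowBead, colBead, YoungDiagram.rowLen_transpose]
  ring

section Flip

variable {μ ν : YoungDiagram} {T : ℕ}

/-- In terms of the column positions, replacing the first column exchanges the contributions of its
pairs with the other columns to the `N + d(i,j)` and to the `h(i,j)`. -/
lemma sum_dExp_add_sum_hook_flip (hcol : ∀ j, ν.colLen (j + 1) = μ.colLen (j + 1))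
    (hT : μ.colLen 0 + ν.colLen 0 = T) (f : ℤ → ℤ) :
    ∑ c ∈ ν.cells, f (T + dExp ν c) + ∑ c ∈ μ.cells, f (hook μ c) =
      ∑ c ∈ μ.cells, f (T + dExp μ c) + ∑ c ∈ ν.cells, f (hook ν c) := by
  obtain ⟨L, hμ, hν⟩ : ∃ L, μ.rowLen 0 ≤ L + 1 ∧ ν.rowLen 0 ≤ L + 1 :=
    ⟨μ.rowLen 0 + ν.rowLen 0, by omega, by omega⟩
  have hbead (j : ℕ) : colBead ν (j + 1) = colBead μ (j + 1) := by rw [colBead, colBead, hcol]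
  have hfirst (m n : ℕ) (hmn : m + n = T) :
      ∑ t ∈ range n, f (T + ((0 : ℕ) - t - 1 + (L + 1 : ℕ))) + ∑ u ∈ range (m + L), f (u + 1) =
        ∑ u ∈ range (T + L), f (u + 1) := by
    rw [show T + L = m + L + n by omega, sum_range_add _ (m + L), add_comm, ← sum_range_reflect _ n]
    congr 1
    refine sum_congr rfl fun t ht => congrArg f ?_
    rw [mem_range] at ht
    omega
  have hpair (ξ : YoungDiagram) (m : ℕ) (hm : ξ.colLen 0 + m = T) :
      ∑ j ∈ range L, f (T + (colBead ξ 0 + colBead μ (j + 1))) =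
        ∑ j ∈ range L, f (colBead μ (j + 1) + m) :=
    sum_congr rfl fun j _ => congrArg f (by rw [colBead]; omega)
  have hsub (ξ : YoungDiagram) :
      ∑ j ∈ range L, f (colBead μ (j + 1) - colBead ξ 0) =
        ∑ j ∈ range L, f (colBead μ (j + 1) + ξ.colLen 0) :=
    sum_congr rfl fun j _ => congrArg f (by rw [colBead.eq_def ξ]; omega)
  have hdμ := sum_dExp_col μ hμ fun n => f (T + n)
  have hdν := sum_dExp_col ν hν fun n => f (T + n)
  have hhμ := sum_hook_colBead μ hμ f
  have hhν := sum_hook_colBead ν hν f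
  simp only [sum_pairs_succ' fun i j => f (T + (colBead μ i + colBead μ j)), hpair μ _ hT,
    sum_range_succ' _ L] at hdμ
  simp only [sum_pairs_succ' fun i j => f (T + (colBead ν i + colBead ν j)), hbead,
    hpair ν _ ((add_comm _ _).trans hT), sum_range_succ' _ L, hcol] at hdν
  rw [sum_pairs_succ', hsub, sum_range_succ' _ L] at hhμ
  simp only [sum_pairs_succ' fun i j => f (colBead ν j - colBead ν i), hbead, hsub,
    sum_range_succ' _ L, hcol] at hhν
  have hμν := hfirst _ _ hT
  have hνμ := hfirst _ _ ((add_comm _ _).trans hT)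
  simp only [add_tsub_cancel_right, tsub_zero] at *
  linarith

lemma gWeight_flip {g : ℤ → ℝ} (hcol : ∀ j, ν.colLen (j + 1) = μ.colLen (j + 1))
    (hT : μ.colLen 0 + ν.colLen 0 = T) (hμ : ∀ c ∈ μ.cells, g (hook μ c) ≠ 0)
    (hν : ∀ c ∈ ν.cells, g (hook ν c) ≠ 0) : gWeight g T ν = gWeight g T μ := by
  have key := prod_eq_prod_of_sum_eq_sum (s := ν.cells.disjSum μ.cells)
    (t := μ.cells.disjSum ν.cells)
    (u := Sum.elim (fun c => T + dExp ν c) (hook μ))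
    (v := Sum.elim (fun c => T + dExp μ c) (hook ν))
    (fun f => by
      simpa only [sum_disjSum, Sum.elim_inl, Sum.elim_inr]
        using sum_dExp_add_sum_hook_flip hcol hT f) g
  simp only [prod_disjSum, Sum.elim_inl, Sum.elim_inr] at key
  rw [gWeight, gWeight, prod_div_distrib, prod_div_distrib,
    div_eq_div_iff (prod_ne_zero_iff.2 hν) (prod_ne_zero_iff.2 hμ), key]

end Flip

lemma card_eq_sum_rowLen (μ : YoungDiagram) {k : ℕ} (hk : μ.colLen 0 ≤ k) :
    μ.card = ∑ i ∈ range k, μ.rowLen i := by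
  simpa [YoungDiagram.card] using sum_cells μ hk fun _ => (1 : ℕ)

lemma card_transpose (μ : YoungDiagram) : μ.transpose.card = μ.card := by
  simp [YoungDiagram.card, YoungDiagram.transpose]

lemma card_eq_sum_colLen (μ : YoungDiagram) {l : ℕ} (hl : μ.rowLen 0 ≤ l) :
    μ.card = ∑ j ∈ range l, μ.colLen j := by
  simpa [card_transpose] using card_eq_sum_rowLen μ.transpose (k := l) (by simpa using hl)

lemma ext_rowLen {μ ν : YoungDiagram} (h : ∀ i, μ.rowLen i = ν.rowLen i) : μ = ν := by
  ext ⟨i, j⟩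
  simp only [YoungDiagram.mem_cells, YoungDiagram.mem_iff_lt_rowLen, h]

lemma ext_colLen {μ ν : YoungDiagram} (h : ∀ j, μ.colLen j = ν.colLen j) : μ = ν :=
  YoungDiagram.transpose_eq_iff.1 (ext_rowLen (by simpa using h))

/-- The diagram with the row lengths `a 0 ≥ a 1 ≥ ⋯`, cut off after the first `k` rows. -/
def ofRowLen (a : ℕ → ℕ) (ha : Antitone a) (k : ℕ) : YoungDiagram where
  cells := {c ∈ range k ×ˢ range (a 0) | c.2 < a c.1}
  isLowerSet := by
    rintro ⟨i, j⟩ ⟨i', j'⟩ hle hmem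
    rw [Prod.mk_le_mk] at hle
    simp only [coe_filter, mem_product, mem_range, Set.mem_ofPred_eq] at hmem ⊢
    have := ha hle.1
    omega

lemma rowLen_ofRowLen {a : ℕ → ℕ} (ha : Antitone a) {k : ℕ} (hk : a k = 0) (i : ℕ) :
    (ofRowLen a ha k).rowLen i = a i :=
  rowLen_eq_of_forall fun j => by
    rw [← YoungDiagram.mem_cells, ofRowLen]
    simp only [mem_filter, mem_product, mem_range]
    have h_zero := ha (Nat.zero_le i)
    have h_cut : k ≤ i → a i ≤ a k := fun h => ha h
    omega

lemma finite_box (h w : ℕ) : {μ : YoungDiagram | μ.colLen 0 ≤ h ∧ μ.rowLen 0 ≤ w}.Finite := by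
  refine Set.Finite.of_finite_image (f := YoungDiagram.cells) ?_ fun μ _ ν _ => YoungDiagram.ext
  refine (range h ×ˢ range w).powerset.finite_toSet.subset ?_
  rintro _ ⟨μ, ⟨hh, hw⟩, rfl⟩
  rw [mem_coe, mem_powerset]
  rintro ⟨i, j⟩ hij
  have hi := YoungDiagram.mem_iff_lt_colLen.1 ((YoungDiagram.mem_cells _).1 hij)
  have hj := YoungDiagram.mem_iff_lt_rowLen.1 ((YoungDiagram.mem_cells _).1 hij)
  rw [mem_product, mem_range, mem_range]
  exact ⟨hi.trans_le ((μ.colLen_anti 0 j (Nat.zero_le _)).trans hh),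
    hj.trans_le ((μ.rowLen_anti 0 i (Nat.zero_le _)).trans hw)⟩

/-- The diagrams with at most `h` rows and at most `w` columns. -/
noncomputable def boxDiagrams (h w : ℕ) : Finset YoungDiagram := (finite_box h w).toFinset

lemma mem_boxDiagrams {h w : ℕ} {μ : YoungDiagram} :
    μ ∈ boxDiagrams h w ↔ μ.colLen 0 ≤ h ∧ μ.rowLen 0 ≤ w := by
  simp [boxDiagrams]

/-- The diagrams with at most `T` boxes in the first two columns and at most `w` columns. -/
noncomputable def colDiagrams (T w : ℕ) : Finset YoungDiagram :=
  {μ ∈ boxDiagrams T w | μ.colLen 0 + μ.colLen 1 ≤ T}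

lemma mem_colDiagrams {T w : ℕ} {μ : YoungDiagram} :
    μ ∈ colDiagrams T w ↔ μ.colLen 0 + μ.colLen 1 ≤ T ∧ μ.rowLen 0 ≤ w := by
  rw [colDiagrams, mem_filter, mem_boxDiagrams]
  omega

lemma filter_colLen_le_colDiagrams {h T w : ℕ} (hT : 2 * h ≤ T) :
    {μ ∈ colDiagrams T w | μ.colLen 0 ≤ h} = boxDiagrams h w := by
  ext μ
  have := μ.colLen_anti 0 1 zero_le_one
  rw [mem_filter, mem_colDiagrams, mem_boxDiagrams]
  omega

/-- Replaces the first column of `μ`, of length `m`, by one of length `T - m`. The maximum only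
matters when the first two columns of `μ` have more than `T` boxes, where the result would not be
a diagram. -/
def flipCol (T : ℕ) (μ : YoungDiagram) : YoungDiagram :=
  (ofRowLen (fun j => if j = 0 then max (T - μ.colLen 0) (μ.colLen 1) else μ.colLen j)
    (antitone_nat_of_succ_le fun j => by
      rcases j with _ | j
      · simp
      · simpa using μ.colLen_anti (j + 1) (j + 2) (Nat.le_succ _))
    (μ.rowLen 0 + 1)).transpose

lemma colLen_flipCol (T : ℕ) (μ : YoungDiagram) (j : ℕ) :
    (flipCol T μ).colLen j =
      if j = 0 then max (T - μ.colLen 0) (μ.colLen 1) else μ.colLen j := by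
  rw [flipCol, YoungDiagram.colLen_transpose, rowLen_ofRowLen]
  rw [if_neg (Nat.succ_ne_zero _), ← YoungDiagram.rowLen_transpose, rowLen_eq_zero_iff,
    YoungDiagram.colLen_transpose]
  exact Nat.le_succ _

lemma colLen_flipCol_succ (T : ℕ) (μ : YoungDiagram) (j : ℕ) :
    (flipCol T μ).colLen (j + 1) = μ.colLen (j + 1) := by
  rw [colLen_flipCol, if_neg j.succ_ne_zero]

section

variable {T w : ℕ} {μ : YoungDiagram}

lemma colLen_zero_add_colLen_flipCol (h : μ ∈ colDiagrams T w) :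
    μ.colLen 0 + (flipCol T μ).colLen 0 = T := by
  have := mem_colDiagrams.1 h
  rw [colLen_flipCol, if_pos rfl]
  omega

lemma flipCol_mem (hw : 0 < w) (h : μ ∈ colDiagrams T w) : flipCol T μ ∈ colDiagrams T w := by
  have hsum := colLen_zero_add_colLen_flipCol h
  have hanti := μ.colLen_anti 0 1 zero_le_one
  obtain ⟨w, rfl⟩ := Nat.exists_eq_succ_of_ne_zero hw.ne'
  rw [mem_colDiagrams, ← YoungDiagram.colLen_transpose, ← rowLen_eq_zero_iff,
    YoungDiagram.rowLen_transpose] at h ⊢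
  rw [colLen_flipCol_succ, colLen_flipCol_succ]
  rw [zero_add] at *
  exact ⟨by omega, h.2⟩

lemma flipCol_flipCol (hw : 0 < w) (h : μ ∈ colDiagrams T w) : flipCol T (flipCol T μ) = μ := by
  have hμ := colLen_zero_add_colLen_flipCol h
  have hν := colLen_zero_add_colLen_flipCol (flipCol_mem hw h)
  refine ext_colLen fun j => ?_
  cases j with
  | zero => omega
  | succ j => rw [colLen_flipCol_succ, colLen_flipCol_succ]

lemma card_flipCol (hw : 0 < w) (h : μ ∈ colDiagrams T w) :
    (flipCol T μ).card + 2 * μ.colLen 0 = μ.card + T := by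
  obtain ⟨w, rfl⟩ := Nat.exists_eq_succ_of_ne_zero hw.ne'
  rw [card_eq_sum_colLen _ (mem_colDiagrams.1 h).2,
    card_eq_sum_colLen _ (mem_colDiagrams.1 (flipCol_mem hw h)).2, sum_range_succ', sum_range_succ']
  simp only [colLen_flipCol_succ]
  linarith [colLen_zero_add_colLen_flipCol h]

end

lemma sum_filter_eq_of_involution {α A : Type*} [AddCommMonoid A] {s : Finset α} {σ : α → α}
    {p q : α → Prop} [DecidablePred p] [DecidablePred q] {F : α → A} (hs : ∀ a ∈ s, σ a ∈ s)
    (hσ : ∀ a ∈ s, σ (σ a) = a) (hF : ∀ a ∈ s, F (σ a) = F a) (hpq : ∀ a ∈ s, q (σ a) ↔ p a) :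
    ∑ a ∈ s with p a, F a = ∑ a ∈ s with q a, F a := by
  simp only [sum_filter]
  refine sum_nbij' σ σ hs hs hσ hσ fun a ha => ?_
  simp only [hpq a ha, hF a ha]

section

variable {h w : ℕ} {F : YoungDiagram → ℝ}

lemma sum_colDiagrams_odd (hw : 0 < w)
    (hF : ∀ μ ∈ colDiagrams (2 * h + 1) w, F (flipCol (2 * h + 1) μ) = F μ) :
    ∑ μ ∈ colDiagrams (2 * h + 1) w with Even μ.card, F μ = ∑ μ ∈ boxDiagrams h w, F μ := by
  have hswap := sum_filter_eq_of_involution (p := fun μ => Even μ.card ∧ ¬ μ.colLen 0 ≤ h)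
    (q := fun μ => μ.colLen 0 ≤ h ∧ ¬ Even μ.card) (fun μ => flipCol_mem hw)
    (fun μ => flipCol_flipCol hw) hF fun μ hμ => by
      have hcard := card_flipCol hw hμ
      have hcol := colLen_zero_add_colLen_flipCol hμ
      simp only [Nat.even_iff]
      omega
  rw [← sum_filter_add_sum_filter_not _ fun μ : YoungDiagram => μ.colLen 0 ≤ h,
    ← sum_filter_add_sum_filter_not (boxDiagrams h w) fun μ : YoungDiagram => Even μ.card,
    ← filter_colLen_le_colDiagrams (Nat.le_succ (2 * h))]
  simp only [filter_filter, hswap, and_comm]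

lemma sum_colDiagrams_even (hw : 0 < w)
    (hF : ∀ μ ∈ colDiagrams (2 * h) w, F (flipCol (2 * h) μ) = F μ) :
    ∑ μ ∈ colDiagrams (2 * h) w with Even μ.card, F μ =
      ∑ μ ∈ boxDiagrams h w with Even μ.card, (if μ.colLen 0 < h then 2 else 1) * F μ := by
  have hswap := sum_filter_eq_of_involution (p := fun μ => Even μ.card ∧ ¬ μ.colLen 0 ≤ h)
    (q := fun μ => (μ.colLen 0 ≤ h ∧ Even μ.card) ∧ μ.colLen 0 < h) (fun μ => flipCol_mem hw)
    (fun μ => flipCol_flipCol hw) hF fun μ hμ => by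
      have hcard := card_flipCol hw hμ
      have hcol := colLen_zero_add_colLen_flipCol hμ
      simp only [Nat.even_iff]
      omega
  have hsplit (μ : YoungDiagram) : (if μ.colLen 0 < h then 2 else 1) * F μ =
      F μ + if μ.colLen 0 < h then F μ else 0 := by
    split_ifs <;> ring
  simp only [hsplit]
  rw [sum_add_distrib, ← sum_filter, ← filter_colLen_le_colDiagrams le_rfl,
    ← sum_filter_add_sum_filter_not _ (fun μ : YoungDiagram => μ.colLen 0 ≤ h)]
  simp only [filter_filter, hswap, and_comm]

end

lemma hook_pos {μ : YoungDiagram} {c : ℕ × ℕ} (hc : c ∈ μ.cells) : 0 < hook μ c := by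
  rw [YoungDiagram.mem_cells] at hc
  have hrow := YoungDiagram.mem_iff_lt_rowLen.1 hc
  have hcol := YoungDiagram.mem_iff_lt_colLen.1 hc
  simp only [hook]
  omega

lemma hook_lt (μ : YoungDiagram) (c : ℕ × ℕ) : hook μ c < μ.rowLen 0 + μ.colLen 0 := by
  have hrow := μ.rowLen_anti 0 c.1 (Nat.zero_le _)
  have hcol := μ.colLen_anti 0 c.2 (Nat.zero_le _)
  simp only [hook]
  omega

lemma add_le_of_strictAnti {k R : ℕ} {p : Fin k → Fin R} (hp : StrictAnti p) (i d : ℕ)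
    (h : i + d < k) : (p ⟨i + d, h⟩ : ℕ) + d ≤ p ⟨i, by omega⟩ := by
  induction d with
  | zero => simp
  | succ d ih =>
    have hstep : p ⟨i + (d + 1), h⟩ < p ⟨i + d, by omega⟩ := hp (Fin.mk_lt_mk.2 (by omega))
    have := ih (by omega)
    rw [Fin.lt_def] at hstep
    omega

lemma exists_shiftedRow_eq {k n : ℕ} {p : Fin k → Fin (n + k)} (hp : StrictAnti p) :
    ∃ μ ∈ boxDiagrams k n, ∀ i : Fin k, shiftedRow k μ i = p i := by
  let a (i : ℕ) : ℕ := if hi : i < k then p ⟨i, hi⟩ - (k - 1 - i) else 0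
  have ha_of_lt {i : ℕ} (hi : i < k) : a i = p ⟨i, hi⟩ - (k - 1 - i) := dif_pos hi
  have ha_of_le {i : ℕ} (hi : k ≤ i) : a i = 0 := dif_neg (by omega)
  have ha : Antitone a := fun i j hij => by
    rcases lt_or_ge j k with hj | hj
    · have hgap := add_le_of_strictAnti hp i (j - i) (by omega)
      simp only [Nat.add_sub_cancel' hij] at hgap
      rw [ha_of_lt hj, ha_of_lt (hij.trans_lt hj)]
      omega
    · exact (ha_of_le hj).trans_le (Nat.zero_le _)
  have hrow := rowLen_ofRowLen ha (ha_of_le le_rfl)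
  refine ⟨ofRowLen a ha k, mem_boxDiagrams.2 ⟨?_, ?_⟩, fun i => ?_⟩
  · rw [← rowLen_eq_zero_iff, hrow, ha_of_le le_rfl]
  · rw [hrow]
    rcases Nat.eq_zero_or_pos k with rfl | hk
    · exact (ha_of_le le_rfl).trans_le (Nat.zero_le _)
    · have := (p ⟨0, hk⟩).2
      rw [ha_of_lt hk]
      omega
  · have := add_le_of_strictAnti hp i (k - 1 - i) (by omega)
    rw [shiftedRow, hrow, ha_of_lt i.2]
    rw [Fin.eta] at *
    omega

lemma shiftedRow_lt_shiftedRow {k i j : ℕ} (μ : YoungDiagram) (hij : i < j) (hj : j < k) :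
    shiftedRow k μ j < shiftedRow k μ i := by
  have := μ.rowLen_anti i j hij.le
  rw [shiftedRow, shiftedRow]
  omega

lemma shiftedRow_lt {k n i : ℕ} {μ : YoungDiagram} (hμ : μ ∈ boxDiagrams k n) (hi : i < k) :
    shiftedRow k μ i < n + k := by
  have hanti := μ.rowLen_anti 0 i (Nat.zero_le _)
  have hrow := (mem_boxDiagrams.1 hμ).2
  rw [shiftedRow]
  omega

lemma eq_of_shiftedRow_eq {k n : ℕ} {μ ν : YoungDiagram} (hμ : μ ∈ boxDiagrams k n)
    (hν : ν ∈ boxDiagrams k n) (h : ∀ i < k, shiftedRow k μ i = shiftedRow k ν i) : μ = ν := by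
  refine ext_rowLen fun i => ?_
  rcases lt_or_ge i k with hi | hi
  · exact Nat.add_right_cancel (h i hi)
  · rw [(rowLen_eq_zero_iff μ).2 ((mem_boxDiagrams.1 hμ).1.trans hi),
      (rowLen_eq_zero_iff ν).2 ((mem_boxDiagrams.1 hν).1.trans hi)]

lemma sum_boxDiagrams {A : Type*} [AddCommMonoid A] (k n : ℕ) (Φ : (Fin k → ℕ) → A) :
    ∑ μ ∈ boxDiagrams k n, Φ (fun i => shiftedRow k μ i) =
      ∑ p : Fin k → Fin (n + k) with StrictAnti p, Φ (fun i => p i) := by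
  refine sum_bij (fun μ hμ i => ⟨shiftedRow k μ i, shiftedRow_lt hμ i.2⟩) ?_ ?_ ?_ fun _ _ => rfl
  · exact fun μ _ => mem_filter.2 ⟨mem_univ _, fun i j hij => shiftedRow_lt_shiftedRow μ hij j.2⟩
  · exact fun μ hμ ν hν heq =>
      eq_of_shiftedRow_eq hμ hν fun i hi => congrArg Fin.val (congrFun heq ⟨i, hi⟩)
  · intro p hp
    obtain ⟨μ, hμ, hp⟩ := exists_shiftedRow_eq (mem_filter.1 hp).2
    exact ⟨μ, hμ, funext fun i => Fin.ext (hp i)⟩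

section Andreief

variable {k : ℕ} {ι A : Type*} [CommRing A]

lemma det_eq_zero_of_not_injective (u : Fin k → ι → A) {p : Fin k → ι}
    (hp : ¬ Function.Injective p) : (Matrix.of fun i j => u j (p i)).det = 0 := by
  simp only [Function.Injective, not_forall] at hp
  obtain ⟨i, j, hij, hne⟩ := hp
  exact Matrix.det_zero_of_row_eq hne (funext fun l => by simp [hij])

variable [Fintype ι]

lemma sum_prod_mul_det (ω : ι → A) (u : Fin k → ι → A) :
    ∑ p : Fin k → ι, (∏ i, ω (p i) * u i (p i)) * (Matrix.of fun i j => u j (p i)).det =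
      (Matrix.of fun i j => ∑ x, ω x * u i x * u j x).det := by
  rw [← Matrix.det_transpose (Matrix.of fun i j => ∑ x, ω x * u i x * u j x), Matrix.det_apply']
  simp only [Matrix.transpose_apply, Matrix.of_apply, prod_univ_sum, Fintype.piFinset_univ,
    mul_sum]
  rw [sum_comm]
  refine sum_congr rfl fun p _ => ?_
  rw [← Matrix.det_transpose, Matrix.det_apply', mul_sum]
  refine sum_congr rfl fun σ _ => ?_
  simp only [Matrix.transpose_apply, Matrix.of_apply, prod_mul_distrib]
  ring

variable [LinearOrder ι]

lemma sum_injective_eq_sum_strictAnti (Ψ : (Fin k → ι) → A) :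
    ∑ p with Function.Injective p, Ψ p =
      ∑ p : Fin k → ι with StrictAnti p, ∑ σ : Equiv.Perm (Fin k), Ψ (p ∘ σ) := by
  rw [sum_sigma']
  symm
  refine sum_bij (fun x _ => x.1 ∘ x.2) ?_ ?_ ?_ fun _ _ => rfl
  · rintro ⟨p, σ⟩ hp
    simp only [mem_sigma, mem_filter, mem_univ, true_and, and_true] at hp ⊢
    exact hp.injective.comp σ.injective
  · rintro ⟨p, σ⟩ hp ⟨q, τ⟩ hq hpq
    simp only [mem_sigma, mem_filter, mem_univ, true_and, and_true] at hp hq hpq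
    have hp' : (p ∘ σ) ∘ (σ⁻¹ : Equiv.Perm (Fin k)) = p := by ext; simp
    have hq' : (p ∘ σ) ∘ (τ⁻¹ : Equiv.Perm (Fin k)) = q := by rw [hpq]; ext; simp
    obtain rfl : p = q := by
      rw [← hp', ← hq']
      exact Tuple.unique_antitone (hp'.symm ▸ hp.antitone) (hq'.symm ▸ hq.antitone)
    obtain rfl : σ = τ := Equiv.ext fun i => hp.injective (congrFun hpq i)
    rfl
  · intro p hp
    set τ : Equiv.Perm (Fin k) := Fin.revPerm.trans (Tuple.sort p)
    have hanti : Antitone (p ∘ τ) := fun i j hij => Tuple.monotone_sort p (Fin.rev_le_rev.2 hij)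
    refine ⟨⟨p ∘ τ, τ⁻¹⟩, ?_, by ext; simp⟩
    simp only [mem_sigma, mem_filter, mem_univ, true_and, and_true] at hp ⊢
    exact hanti.strictAnti_of_injective (hp.comp τ.injective)

/-- Andréief's identity, for a measure with finite support. -/
lemma sum_strictAnti_det_sq (ω : ι → A) (u : Fin k → ι → A) :
    ∑ p : Fin k → ι with StrictAnti p,
        (∏ i, ω (p i)) * (Matrix.of fun i j => u j (p i)).det ^ 2 =
      (Matrix.of fun i j => ∑ x, ω x * u i x * u j x).det := by
  have hinj (p : Fin k → ι) (_ : p ∈ univ)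
      (hp : (∏ i, ω (p i) * u i (p i)) * (Matrix.of fun i j => u j (p i)).det ≠ 0) :
      Function.Injective p :=
    not_imp_comm.1 (det_eq_zero_of_not_injective u) (right_ne_zero_of_mul hp)
  rw [← sum_prod_mul_det, ← sum_filter_of_ne hinj, sum_injective_eq_sum_strictAnti]
  refine sum_congr rfl fun p _ => ?_
  have hdet (σ : Equiv.Perm (Fin k)) : (Matrix.of fun i j => u j ((p ∘ σ) i)).det =
      (Equiv.Perm.sign σ : ℤ) * (Matrix.of fun i j => u j (p i)).det :=
    Matrix.det_permute σ (Matrix.of fun i j => u j (p i))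
  have hω (σ : Equiv.Perm (Fin k)) : ∏ i, ω ((p ∘ σ) i) = ∏ i, ω (p i) :=
    Equiv.prod_comp σ fun i => ω (p i)
  rw [sq, ← mul_assoc]
  nth_rw 1 [Matrix.det_apply']
  rw [mul_sum, sum_mul]
  refine sum_congr rfl fun σ _ => ?_
  rw [prod_mul_distrib, hdet, hω]
  simp only [Matrix.of_apply, Function.comp_apply]
  ring

end Andreief

section RecPoly

open Polynomial

variable {A : Type*} [CommRing A]

/-- The variants of the Chebyshev polynomials with `P₀ = 1`, `P₁ = X + c`: at `X = 2 cos θ` and for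
`c = 1, 0, -1` they are `sin ((j + 1/2) θ)`, `sin ((j + 1) θ)` and `cos ((j + 1/2) θ)`, up to a
factor which only depends on `θ`. -/
noncomputable def recPoly (c : A) : ℕ → A[X]
  | 0 => 1
  | 1 => X + C c
  | j + 2 => X * recPoly c (j + 1) - recPoly c j

lemma recPoly_monic_natDegree [Nontrivial A] (c : A) (j : ℕ) :
    (recPoly c j).Monic ∧ (recPoly c j).natDegree = j := by
  induction j using Nat.twoStepInduction with
  | zero => exact ⟨monic_one, natDegree_one⟩
  | one => exact ⟨monic_X_add_C c, natDegree_X_add_C c⟩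
  | more j hj hj' =>
    have hX : (X * recPoly c (j + 1)).Monic := monic_X.mul hj'.1
    have hdeg : (X * recPoly c (j + 1)).natDegree = j + 2 := by
      rw [monic_X.natDegree_mul hj'.1, natDegree_X, hj'.2, add_comm]
    have hlt : (recPoly c j).natDegree < (X * recPoly c (j + 1)).natDegree := by omega
    exact ⟨hX.sub_of_left (degree_lt_degree hlt),
      (natDegree_sub_eq_left_of_natDegree_lt hlt).trans hdeg⟩

lemma eval_recPoly {c y : A} {u : ℕ → A} (h_one : u 1 = (y + c) * u 0)
    (h_rec : ∀ j, u (j + 2) = y * u (j + 1) - u j) (j : ℕ) :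
    u j = u 0 * (recPoly c j).eval y := by
  induction j using Nat.twoStepInduction with
  | zero => simp [recPoly]
  | one => simp [recPoly, h_one, mul_comm]
  | more j hj hj' =>
    rw [h_rec, hj, hj', recPoly, eval_sub, eval_mul, eval_X]
    ring

end RecPoly

lemma prod_univ_Ioi_eq {A : Type*} [CommMonoid A] (k : ℕ) (F : ℕ → ℕ → A) :
    ∏ i : Fin k, ∏ j ∈ Ioi i, F i j = ∏ i ∈ range k, ∏ j ∈ Ico (i + 1) k, F i j := by
  rw [← Fin.prod_univ_eq_prod_range fun i => ∏ j ∈ Ico (i + 1) k, F i j]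
  refine prod_congr rfl fun i _ => ?_
  rw [Ico_add_one_left_eq_Ioo, ← Fin.map_valEmbedding_Ioi, prod_map]
  rfl

section Vandermonde

variable {A : Type*} [CommRing A] {k n : ℕ} (ω y : ℕ → A) {c : A} {u : ℕ → ℕ → A}

lemma det_eq_prod_mul_vandermonde [Nontrivial A] (h_one : ∀ x, u 1 x = (y x + c) * u 0 x)
    (h_rec : ∀ j x, u (j + 2) x = y x * u (j + 1) x - u j x) (p : Fin k → ℕ) :
    (Matrix.of fun i j : Fin k => u j (p i)).det =
      (∏ i, u 0 (p i)) * ∏ i : Fin k, ∏ j ∈ Ioi i, (y (p j) - y (p i)) := by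
  rw [← Matrix.det_vandermonde fun i => y (p i),
    Matrix.det_eval_matrixOfPolynomials_eq_det_vandermonde _ (fun j : Fin k => recPoly c j)
      (fun j => (recPoly_monic_natDegree c j).2) (fun j => (recPoly_monic_natDegree c j).1),
    ← Matrix.det_mul_column]
  congr 1
  ext i j
  exact eval_recPoly (u := fun j => u j (p i)) (h_one _) (fun j => h_rec j _) j

lemma sum_boxDiagrams_eq_det [Nontrivial A] (h_one : ∀ x, u 1 x = (y x + c) * u 0 x)
    (h_rec : ∀ j x, u (j + 2) x = y x * u (j + 1) x - u j x) :
    ∑ μ ∈ boxDiagrams k n,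
        (∏ i ∈ range k, ω (shiftedRow k μ i) * u 0 (shiftedRow k μ i) ^ 2) *
          ∏ i ∈ range k, ∏ j ∈ Ico (i + 1) k, (y (shiftedRow k μ i) - y (shiftedRow k μ j)) ^ 2 =
      (Matrix.of fun i j : Fin k => ∑ x ∈ range (n + k), ω x * u i x * u j x).det := by
  simp only [← prod_univ_Ioi_eq k fun _ _ => (_ : A) ^ 2, ← Fin.prod_univ_eq_prod_range,
    ← Fin.sum_univ_eq_sum_range]
  rw [sum_boxDiagrams k n fun p => (∏ i, ω (p i) * u 0 (p i) ^ 2) *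
    ∏ i, ∏ j ∈ Ioi i, (y (p i) - y (p j)) ^ 2,
    ← sum_strictAnti_det_sq (fun x : Fin (n + k) => ω x) (fun j x => u j x)]
  refine sum_congr rfl fun p _ => ?_
  rw [det_eq_prod_mul_vandermonde y h_one h_rec fun i => p i, mul_pow, prod_mul_distrib,
    ← prod_pow, ← prod_pow, mul_assoc]
  simp only [← prod_pow, sub_sq_comm]

end Vandermonde

open Real

/-- The number `4 sin²(nπ/ℓ)`. -/
noncomputable def sinSq (ℓ : ℕ) (n : ℤ) : ℝ := 4 * sin (n * π / ℓ) ^ 2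

lemma sinSq_neg (ℓ : ℕ) (n : ℤ) : sinSq ℓ (-n) = sinSq ℓ n := by
  rw [sinSq, sinSq, Int.cast_neg, neg_mul, neg_div, sin_neg, neg_sq]

lemma sinSq_natCast_sub {ℓ : ℕ} (hℓ : 0 < ℓ) (n : ℤ) : sinSq ℓ (ℓ - n) = sinSq ℓ n := by
  have hangle : ((ℓ - n : ℤ) : ℝ) * π / ℓ = π - n * π / ℓ := by
    push_cast
    field_simp
  rw [sinSq, sinSq, hangle, sin_pi_sub]

lemma sin_int_mul_pi_div_ne_zero {ℓ : ℕ} {n : ℤ} (hn : n ≠ 0) (hnℓ : |n| < ℓ) :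
    sin (n * π / ℓ) ≠ 0 := by
  have hℓ : (0 : ℝ) < ℓ := by exact_mod_cast (abs_nonneg n).trans_lt hnℓ
  rw [Ne, sin_eq_zero_iff]
  rintro ⟨m, hm⟩
  rw [eq_div_iff hℓ.ne', mul_right_comm] at hm
  have hmn : m * ℓ = n := by exact_mod_cast mul_right_cancel₀ pi_ne_zero hm
  exact hn (Int.eq_zero_of_abs_lt_dvd ⟨m, by rw [← hmn, mul_comm]⟩ hnℓ)

lemma sinSq_ne_zero {ℓ : ℕ} {n : ℤ} (hn : 0 < n) (hnℓ : n < ℓ) : sinSq ℓ n ≠ 0 :=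
  mul_ne_zero four_ne_zero
    (pow_ne_zero 2 (sin_int_mul_pi_div_ne_zero hn.ne' (by rwa [abs_of_pos hn])))

/-- Half the angle `θ = (2x + δ)π/ℓ`; the numbers `2 cos θ` are the nodes of the Vandermonde
determinants. -/
noncomputable def halfAngle (ℓ : ℕ) (δ : ℤ) (x : ℕ) : ℝ := (2 * x + δ) * π / (2 * ℓ)

lemma sinSq_mul_sinSq (ℓ : ℕ) (δ : ℤ) (a b : ℕ) :
    sinSq ℓ (a - b) * sinSq ℓ (a + b + δ) =
      (2 * cos (2 * halfAngle ℓ δ a) - 2 * cos (2 * halfAngle ℓ δ b)) ^ 2 := by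
  rw [← mul_sub, cos_sub_cos, sinSq, sinSq, halfAngle, halfAngle]
  push_cast
  ring_nf

lemma pairProd_sinSq (ℓ k : ℕ) (δ : ℤ) (p : ℕ → ℕ) :
    pairProd (sinSq ℓ) k δ p = ∏ i ∈ range k, ∏ j ∈ Ico (i + 1) k,
      (2 * cos (2 * halfAngle ℓ δ (p i)) - 2 * cos (2 * halfAngle ℓ δ (p j))) ^ 2 := by
  simp only [pairProd, sinSq_mul_sinSq]

section CosSum

/-- The sum of the `2 cos(cθ_x)` with weights `ω x`, over the angles `θ_x = (2x + δ)π/ℓ`. -/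
noncomputable def cosSum (ω : ℕ → ℝ) (ℓ : ℕ) (δ : ℤ) (R : ℕ) (c : ℤ) : ℝ :=
  ∑ x ∈ range R, ω x * (2 * cos (2 * c * halfAngle ℓ δ x))

variable {ω : ℕ → ℝ} {ℓ k n m : ℕ} {δ : ℤ}

lemma sum_boxDiagrams_sin {a : ℝ}
    (h_one : ∀ t, sin ((m + 2) * t) = (2 * cos (2 * t) + a) * sin (m * t)) :
    ∑ μ ∈ boxDiagrams k n,
        (∏ i ∈ range k, ω (shiftedRow k μ i) *
          (2 * sin (m * halfAngle ℓ δ (shiftedRow k μ i))) ^ 2) *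
            pairProd (sinSq ℓ) k δ (shiftedRow k μ) =
      (Matrix.of fun i j : Fin k =>
        cosSum ω ℓ δ (n + k) (i - j) - cosSum ω ℓ δ (n + k) (i + j + m)).det := by
  have hrec (s t : ℝ) : 2 * sin (s + t) = 2 * cos t * (2 * sin s) - 2 * sin (s - t) := by
    rw [sin_add, sin_sub]
    ring
  have hmul (s t : ℝ) : 2 * sin s * (2 * sin t) = 2 * cos (s - t) - 2 * cos (s + t) := by
    rw [cos_add, cos_sub]
    ring
  have hdet := sum_boxDiagrams_eq_det (k := k) (n := n) ω (fun x => 2 * cos (2 * halfAngle ℓ δ x))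
    (u := fun j x => 2 * sin ((2 * j + m) * halfAngle ℓ δ x)) (c := a)
    (fun x => by
      rw [mul_left_comm, Nat.cast_zero, mul_zero, zero_add, ← h_one, Nat.cast_one, mul_one,
        add_comm])
    (fun j x => by
      convert hrec ((2 * (j + 1 : ℕ) + m) * halfAngle ℓ δ x) (2 * halfAngle ℓ δ x) using 3 <;>
        push_cast <;> ring_nf)
  simp only [← pairProd_sinSq, Nat.cast_zero, mul_zero, zero_add] at hdet
  rw [hdet]
  congr 2
  ext i j
  rw [cosSum, cosSum, ← sum_sub_distrib]
  refine sum_congr rfl fun x _ => ?_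
  rw [mul_assoc, hmul, mul_sub]
  congr! 4 <;> push_cast <;> ring

lemma sum_boxDiagrams_cos :
    ∑ μ ∈ boxDiagrams k n,
        (∏ i ∈ range k, ω (shiftedRow k μ i) *
          (2 * cos (halfAngle ℓ δ (shiftedRow k μ i))) ^ 2) *
            pairProd (sinSq ℓ) k δ (shiftedRow k μ) =
      (Matrix.of fun i j : Fin k =>
        cosSum ω ℓ δ (n + k) (i - j) + cosSum ω ℓ δ (n + k) (i + j + 1)).det := by
  have hrec (s t : ℝ) : 2 * cos (s + t) = 2 * cos t * (2 * cos s) - 2 * cos (s - t) := by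
    rw [cos_add, cos_sub]
    ring
  have hmul (s t : ℝ) : 2 * cos s * (2 * cos t) = 2 * cos (s - t) + 2 * cos (s + t) := by
    rw [cos_add, cos_sub]
    ring
  have hdet := sum_boxDiagrams_eq_det (k := k) (n := n) ω (fun x => 2 * cos (2 * halfAngle ℓ δ x))
    (u := fun j x => 2 * cos ((2 * j + 1) * halfAngle ℓ δ x)) (c := -1)
    (fun x => by
      have h := hrec (halfAngle ℓ δ x) (2 * halfAngle ℓ δ x)
      rw [show halfAngle ℓ δ x - 2 * halfAngle ℓ δ x = -halfAngle ℓ δ x by ring, cos_neg] at h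
      push_cast
      ring_nf at h ⊢
      exact h)
    (fun j x => by
      convert hrec ((2 * (j + 1 : ℕ) + 1) * halfAngle ℓ δ x) (2 * halfAngle ℓ δ x) using 3 <;>
        push_cast <;> ring_nf)
  simp only [← pairProd_sinSq, Nat.cast_zero, mul_zero, zero_add, one_mul] at hdet
  rw [hdet]
  congr 2
  ext i j
  rw [cosSum, cosSum, ← sum_add_distrib]
  refine sum_congr rfl fun x _ => ?_
  rw [mul_assoc, hmul, mul_add]
  congr! 4 <;> push_cast <;> ring

end CosSum

section CosSumValues

variable {ω : ℕ → ℝ} {ℓ k m R d : ℕ} {δ c : ℤ}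

lemma sin_mul_sum_cos (φ δ : ℝ) (R : ℕ) :
    sin φ * ∑ x ∈ range R, 2 * cos ((2 * x + δ) * φ) =
      sin ((2 * R + δ - 1) * φ) - sin ((δ - 1) * φ) := by
  have hstep (x : ℕ) : sin φ * (2 * cos ((2 * x + δ) * φ)) =
      sin ((2 * (x + 1 : ℕ) + δ - 1) * φ) - sin ((2 * x + δ - 1) * φ) := by
    have hlast : (2 * (x + 1 : ℕ) + δ - 1) * φ = (2 * x + δ) * φ + φ := by
      push_cast
      ring
    rw [hlast, sub_one_mul, sin_add, sin_sub]
    ring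
  rw [mul_sum, sum_congr rfl fun x _ => hstep x,
    sum_range_sub fun x : ℕ => sin ((2 * x + δ - 1) * φ)]
  simp

lemma two_mul_intCast_mul_halfAngle (ℓ : ℕ) (δ c : ℤ) (x : ℕ) :
    2 * c * halfAngle ℓ δ x = (2 * x + δ) * (c * π / ℓ) := by
  rw [halfAngle]
  ring

lemma cosSum_zero (ω : ℕ → ℝ) (ℓ : ℕ) (δ : ℤ) (R : ℕ) :
    cosSum ω ℓ δ R 0 = 2 * ∑ x ∈ range R, ω x := by
  simp [cosSum, ← sum_mul, mul_comm]

lemma sin_mul_cosSum_one (ℓ : ℕ) (δ : ℤ) (R : ℕ) (c : ℤ) :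
    sin (c * π / ℓ) * cosSum (fun _ => 1) ℓ δ R c =
      sin ((2 * R + δ - 1) * (c * π / ℓ)) - sin ((δ - 1) * (c * π / ℓ)) := by
  simp only [cosSum, one_mul, two_mul_intCast_mul_halfAngle, sin_mul_sum_cos]

lemma cosSum_odd_one (hℓ : ℓ = 2 * R + 1) (hcℓ : |c| < ℓ) :
    cosSum (fun _ => 1) ℓ 1 R c = (if c = 0 then (ℓ : ℝ) else 0) - (-1) ^ c := by
  have hℓ' : (ℓ : ℝ) = 2 * R + 1 := by exact_mod_cast hℓ
  split_ifs with hc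
  · simp [hc, cosSum_zero, hℓ']
  · have hangle : (2 * R + (1 : ℤ) - 1) * (c * π / ℓ) = c * π - c * π / ℓ := by
      rw [hℓ']
      field_simp
      push_cast
      ring
    apply mul_left_cancel₀ (sin_int_mul_pi_div_ne_zero hc hcℓ)
    rw [sin_mul_cosSum_one, hangle, sin_int_mul_pi_sub]
    simp [mul_comm]

lemma cosSum_odd_two (hℓ : ℓ = 2 * R + 1) (hcℓ : |c| < ℓ) :
    cosSum (fun _ => 1) ℓ 2 R c = (if c = 0 then (ℓ : ℝ) else 0) - 1 := by
  have hℓ' : (ℓ : ℝ) = 2 * R + 1 := by exact_mod_cast hℓ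
  split_ifs with hc
  · simp [hc, cosSum_zero, hℓ']
  · have hangle : (2 * R + (2 : ℤ) - 1) * (c * π / ℓ) = c * π := by
      rw [hℓ']
      field_simp
      push_cast
      ring
    apply mul_left_cancel₀ (sin_int_mul_pi_div_ne_zero hc hcℓ)
    rw [sin_mul_cosSum_one, hangle, sin_int_mul_pi]
    norm_num

/-- The weight which is `1/2` at `a` and `1` elsewhere. -/
noncomputable def halfAt (a x : ℕ) : ℝ := if x = a then 1 / 2 else 1

lemma sum_halfAt_mul {a : ℕ} (ha : a < R) (F : ℕ → ℝ) :
    ∑ x ∈ range R, halfAt a x * F x = ∑ x ∈ range R, F x - F a / 2 := by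
  have hsplit (x : ℕ) : halfAt a x * F x = F x - if x = a then F x / 2 else 0 := by
    rw [halfAt]
    split_ifs <;> ring
  simp only [hsplit, sum_sub_distrib, sum_ite_eq', if_pos (mem_range.2 ha)]

lemma cosSum_halfAt {a : ℕ} (ha : a < R) (c : ℤ) :
    cosSum (halfAt a) ℓ δ R c =
      cosSum (fun _ => 1) ℓ δ R c - cos ((2 * a + δ) * (c * π / ℓ)) := by
  rw [cosSum, sum_halfAt_mul ha, two_mul_intCast_mul_halfAngle, cosSum]
  simp

lemma cosSum_even_zero (hR : 0 < R) (hℓ : ℓ = 2 * R) (hcℓ : |c| < ℓ) :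
    cosSum (halfAt 0) ℓ 0 R c = (if c = 0 then (ℓ : ℝ) else 0) - (-1) ^ c := by
  have hℓ' : (ℓ : ℝ) = 2 * R := by exact_mod_cast hℓ
  rw [cosSum_halfAt hR]
  split_ifs with hc
  · simp [hc, cosSum_zero, hℓ']
  · have hangle : (2 * R + (0 : ℤ) - 1) * (c * π / ℓ) = c * π - c * π / ℓ := by
      rw [hℓ']
      field_simp
      push_cast
      ring
    apply mul_left_cancel₀ (sin_int_mul_pi_div_ne_zero hc hcℓ)
    rw [mul_sub, sin_mul_cosSum_one, hangle, sin_int_mul_pi_sub]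
    simp [mul_comm]

lemma cosSum_even_two (hR : 0 < R) (hℓ : ℓ = 2 * R) (hcℓ : |c| < ℓ) :
    cosSum (halfAt (R - 1)) ℓ 2 R c = (if c = 0 then (ℓ : ℝ) else 0) - 1 := by
  have hℓ' : (ℓ : ℝ) = 2 * R := by exact_mod_cast hℓ
  rw [cosSum_halfAt (Nat.sub_lt hR one_pos)]
  split_ifs with hc
  · simp [hc, cosSum_zero, hℓ']
  · have hangle : (2 * R + (2 : ℤ) - 1) * (c * π / ℓ) = c * π / ℓ + c * π := by
      rw [hℓ']
      field_simp
      push_cast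
      ring
    have hlast : (2 * (R - 1 : ℕ) + (2 : ℤ)) * (c * π / ℓ) = c * π := by
      rw [Nat.cast_pred hR, hℓ']
      field_simp
      push_cast
      ring
    apply mul_left_cancel₀ (sin_int_mul_pi_div_ne_zero hc hcℓ)
    rw [mul_sub, sin_mul_cosSum_one, hangle, hlast, sin_add_int_mul_pi, cos_int_mul_pi]
    norm_num
    ring

lemma cosSum_alternating (hR : 0 < R) (hℓ : ℓ = 2 * R) (hδ : δ = 2 * d) (c : ℤ) :
    cosSum (fun x => (-1) ^ x * ω x) ℓ δ R c = (-1) ^ d * cosSum ω ℓ δ R (R + c) := by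
  have hangle (x : ℕ) : 2 * ((R + c : ℤ) : ℝ) * halfAngle ℓ δ x =
      2 * c * halfAngle ℓ δ x + (x + d : ℕ) * π := by
    rw [halfAngle, hδ, hℓ]
    push_cast
    field_simp
    ring
  rw [cosSum, cosSum, mul_sum]
  refine sum_congr rfl fun x _ => ?_
  rw [hangle, cos_add_nat_mul_pi]
  have hsq : ((-1 : ℝ) ^ d) ^ 2 = 1 := by rw [← pow_mul, pow_mul', neg_one_sq, one_pow]
  rw [pow_add]
  linear_combination (-(-1) ^ x * ω x * (2 * cos (2 * c * halfAngle ℓ δ x))) * hsq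

lemma det_gram {S ε : ℤ → ℝ} {s : ℝ} (hm : 0 < m) (hk : 2 * k + m ≤ ℓ + 1)
    (hS : ∀ c : ℤ, |c| < ℓ → S c = (if c = 0 then (ℓ : ℝ) else 0) - ε c)
    (hε : ∀ i j : ℕ, s * ε (i + j + m) = ε (i - j)) :
    (Matrix.of fun i j : Fin k => S (i - j) - s * S (i + j + m)).det = (ℓ : ℝ) ^ k := by
  have hdiag : (Matrix.of fun i j : Fin k => S (i - j) - s * S (i + j + m)) =
      Matrix.diagonal fun _ => (ℓ : ℝ) := by
    ext i j
    have hsub : (i - j : ℤ) = 0 ↔ i = j := by rw [sub_eq_zero, Nat.cast_inj, Fin.val_inj]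
    rw [Matrix.of_apply, hS _ (by rw [abs_lt]; omega), hS (i + j + m) (by rw [abs_lt]; omega),
      if_neg (by omega : (i + j + m : ℤ) ≠ 0), Matrix.diagonal_apply, ← hε]
    simp only [hsub]
    ring
  rw [hdiag, Matrix.det_diagonal, prod_const, card_univ, Fintype.card_fin]

end CosSumValues

section BoxSums

variable {ω : ℕ → ℝ} {ℓ k n : ℕ}

lemma sum_boxDiagrams_odd_one (hℓ : ℓ = 2 * (n + k) + 1) :
    ∑ μ ∈ boxDiagrams k n, pairProd (sinSq ℓ) k 1 (shiftedRow k μ) *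
      ∏ i ∈ range k, sinSq ℓ (2 * shiftedRow k μ i + 1) = (ℓ : ℝ) ^ k := by
  have hsin (x : ℕ) : (2 * sin ((2 : ℕ) * halfAngle ℓ 1 x)) ^ 2 = sinSq ℓ (2 * x + 1) := by
    rw [halfAngle, sinSq, mul_pow]
    congr! 3
    · norm_num
    · push_cast
      ring
  have hsum := sum_boxDiagrams_sin (ω := fun _ => 1) (ℓ := ℓ) (k := k) (n := n) (m := 2) (δ := 1)
    (a := 0) fun t => by
      rw [add_zero, Nat.cast_ofNat, two_add_two_eq_four, mul_right_comm, ← sin_two_mul]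
      ring_nf
  simp only [one_mul, hsin] at hsum
  simp only [mul_comm (pairProd _ _ _ _), hsum]
  have hdet := det_gram (k := k) (S := cosSum (fun _ => 1) ℓ 1 (n + k)) (ε := fun c => (-1) ^ c)
    (s := 1) two_pos (by omega) (fun c => cosSum_odd_one hℓ) fun i j => by
      have hparity : (i + j + (2 : ℕ) : ℤ) = (i - j) + 2 * (j + 1) := by
        push_cast
        ring
      rw [one_mul, hparity, zpow_add₀ (by norm_num), (even_two_mul _).neg_one_zpow, mul_one]
  simpa only [one_mul] using hdet

lemma sin_three_mul_eq (t : ℝ) :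
    sin (((1 : ℕ) + 2) * t) = (2 * cos (2 * t) + 1) * sin ((1 : ℕ) * t) := by
  have hangle : ((1 : ℕ) + 2) * t = 2 * t + t := by
    push_cast
    ring
  have hback : sin (2 * t - t) = sin t := by ring_nf
  rw [sin_sub] at hback
  rw [hangle, sin_add, Nat.cast_one, one_mul]
  linear_combination hback

lemma sum_boxDiagrams_two_eq_det (ω : ℕ → ℝ) :
    ∑ μ ∈ boxDiagrams k n,
        (∏ i ∈ range k, ω (shiftedRow k μ i) * sinSq ℓ (shiftedRow k μ i + 1)) *
          pairProd (sinSq ℓ) k 2 (shiftedRow k μ) =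
      (Matrix.of fun i j : Fin k =>
        cosSum ω ℓ 2 (n + k) (i - j) - cosSum ω ℓ 2 (n + k) (i + j + (1 : ℕ))).det := by
  have hsin (x : ℕ) : sinSq ℓ (x + 1) = (2 * sin ((1 : ℕ) * halfAngle ℓ 2 x)) ^ 2 := by
    rw [halfAngle, sinSq, mul_pow]
    congr! 3
    · norm_num
    · push_cast
      ring
  simp only [hsin, sum_boxDiagrams_sin sin_three_mul_eq]

lemma sum_boxDiagrams_odd_two (hℓ : ℓ = 2 * (n + k) + 1) :
    ∑ μ ∈ boxDiagrams k n, pairProd (sinSq ℓ) k 2 (shiftedRow k μ) *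
      ∏ i ∈ range k, sinSq ℓ (shiftedRow k μ i + 1) = (ℓ : ℝ) ^ k := by
  have hdet := sum_boxDiagrams_two_eq_det (ℓ := ℓ) (k := k) (n := n) fun _ => 1
  simp only [one_mul] at hdet
  simp only [mul_comm (pairProd _ _ _ _), hdet]
  have hgram := det_gram (k := k) (S := cosSum (fun _ => 1) ℓ 2 (n + k)) (ε := fun _ => 1)
    (s := 1) one_pos (by omega) (fun c => cosSum_odd_two hℓ) fun _ _ => one_mul 1
  simpa only [one_mul] using hgram

lemma sum_boxDiagrams_even_two (hn : 0 < n) (hℓ : ℓ = 2 * (n + k)) :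
    ∑ μ ∈ boxDiagrams k n,
      (∏ i ∈ range k, halfAt (n + k - 1) (shiftedRow k μ i) * sinSq ℓ (shiftedRow k μ i + 1)) *
        pairProd (sinSq ℓ) k 2 (shiftedRow k μ) = (ℓ : ℝ) ^ k := by
  have hgram := det_gram (k := k) (S := cosSum (halfAt (n + k - 1)) ℓ 2 (n + k))
    (ε := fun _ => 1) (s := 1) one_pos (by omega)
    (fun c => cosSum_even_two (by omega) hℓ) fun _ _ => one_mul 1
  simpa only [one_mul, sum_boxDiagrams_two_eq_det] using hgram

lemma sum_boxDiagrams_even_two_alternating (hk : 0 < k) (hn : 0 < n) (hℓ : ℓ = 2 * (n + k)) :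
    ∑ μ ∈ boxDiagrams k n,
      (∏ i ∈ range k, (-1) ^ shiftedRow k μ i * halfAt (n + k - 1) (shiftedRow k μ i) *
        sinSq ℓ (shiftedRow k μ i + 1)) * pairProd (sinSq ℓ) k 2 (shiftedRow k μ) = 0 := by
  rw [sum_boxDiagrams_two_eq_det fun x => (-1) ^ x * halfAt (n + k - 1) x]
  refine Matrix.det_eq_zero_of_row_eq_zero ⟨0, hk⟩ fun j => ?_
  have hR : 0 < n + k := by omega
  rw [Matrix.of_apply, Nat.cast_zero, cosSum_alternating hR hℓ (δ := 2) (d := 1) rfl,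
    cosSum_alternating hR hℓ (δ := 2) (d := 1) rfl,
    cosSum_even_two hR hℓ (by rw [abs_lt]; omega), cosSum_even_two hR hℓ (by rw [abs_lt]; omega),
    if_neg (by omega), if_neg (by omega), sub_self]

lemma sum_boxDiagrams_even_zero (hn : 0 < n) (hℓ : ℓ = 2 * (n + k)) :
    ∑ μ ∈ boxDiagrams k n,
      (∏ i ∈ range k, halfAt 0 (shiftedRow k μ i) *
        (2 * cos (halfAngle ℓ 0 (shiftedRow k μ i))) ^ 2) *
          pairProd (sinSq ℓ) k 0 (shiftedRow k μ) = (ℓ : ℝ) ^ k := by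
  have hgram := det_gram (k := k) (S := cosSum (halfAt 0) ℓ 0 (n + k)) (ε := fun c => (-1) ^ c)
    (s := -1) one_pos (by omega) (fun c => cosSum_even_zero (by omega) hℓ) fun i j => by
      have hparity : (i + j + (1 : ℕ) : ℤ) = (i - j) + (2 * j + 1) := by
        push_cast
        ring
      rw [hparity, zpow_add₀ (by norm_num), (odd_two_mul_add_one _).neg_one_zpow]
      ring
  simpa only [neg_mul, one_mul, sub_neg_eq_add, sum_boxDiagrams_cos, Nat.cast_one] using hgram

lemma sum_boxDiagrams_even_zero_alternating (hk : 0 < k) (hn : 0 < n) (hℓ : ℓ = 2 * (n + k)) :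
    ∑ μ ∈ boxDiagrams k n,
      (∏ i ∈ range k, (-1) ^ shiftedRow k μ i * halfAt 0 (shiftedRow k μ i) *
        (2 * cos (halfAngle ℓ 0 (shiftedRow k μ i))) ^ 2) *
          pairProd (sinSq ℓ) k 0 (shiftedRow k μ) = 0 := by
  rw [sum_boxDiagrams_cos (ω := fun x => (-1) ^ x * halfAt 0 x)]
  refine Matrix.det_eq_zero_of_row_eq_zero ⟨0, hk⟩ fun j => ?_
  have hR : 0 < n + k := by omega
  have hsign : (-1 : ℝ) ^ ((n + k : ℕ) + (0 + j + 1) : ℤ) =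
      -(-1) ^ ((n + k : ℕ) + (0 - j) : ℤ) := by
    have hparity : ((n + k : ℕ) + (0 + j + 1) : ℤ) = ((n + k : ℕ) + (0 - j)) + (2 * j + 1) := by
      ring
    rw [hparity, zpow_add₀ (by norm_num), (odd_two_mul_add_one _).neg_one_zpow, mul_neg_one]
  rw [Matrix.of_apply, Nat.cast_zero, cosSum_alternating hR hℓ (δ := 0) (d := 0) rfl,
    cosSum_alternating hR hℓ (δ := 0) (d := 0) rfl,
    cosSum_even_zero hR hℓ (by rw [abs_lt]; omega), cosSum_even_zero hR hℓ (by rw [abs_lt]; omega),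
    if_neg (by omega), if_neg (by omega), hsign]
  ring

end BoxSums

section EvenDiagrams

variable {k n : ℕ} {μ : YoungDiagram}

lemma sum_filter_even_card (s : Finset YoungDiagram) (F : YoungDiagram → ℝ) :
    ∑ μ ∈ s with Even μ.card, F μ =
      (∑ μ ∈ s, F μ + ∑ μ ∈ s, (-1) ^ μ.card * F μ) / 2 := by
  rw [sum_filter, ← sum_add_distrib, sum_div]
  refine sum_congr rfl fun μ _ => ?_
  split_ifs with hcard
  · rw [hcard.neg_one_pow]
    ring
  · rw [(Nat.not_even_iff_odd.1 hcard).neg_one_pow]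
    ring

lemma prod_neg_one_pow_shiftedRow (hμ : μ.colLen 0 ≤ k) :
    ∏ i ∈ range k, (-1 : ℝ) ^ shiftedRow k μ i =
      (-1) ^ (∑ i ∈ range k, (k - 1 - i)) * (-1) ^ μ.card := by
  simp only [shiftedRow, pow_add, prod_mul_distrib, card_eq_sum_rowLen μ hμ, prod_pow_eq_pow_sum,
    mul_comm]

lemma sum_boxDiagrams_even_card {ω U : ℕ → ℝ} {D : YoungDiagram → ℝ} {a : ℝ}
    (h_sum : ∑ μ ∈ boxDiagrams k n,
      (∏ i ∈ range k, ω (shiftedRow k μ i) * U (shiftedRow k μ i)) * D μ = a)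
    (h_alt : ∑ μ ∈ boxDiagrams k n, (∏ i ∈ range k, (-1) ^ shiftedRow k μ i *
      ω (shiftedRow k μ i) * U (shiftedRow k μ i)) * D μ = 0) :
    ∑ μ ∈ boxDiagrams k n with Even μ.card,
      (∏ i ∈ range k, ω (shiftedRow k μ i) * U (shiftedRow k μ i)) * D μ = a / 2 := by
  have hcard : ∑ μ ∈ boxDiagrams k n, (-1) ^ μ.card *
      ((∏ i ∈ range k, ω (shiftedRow k μ i) * U (shiftedRow k μ i)) * D μ) = 0 := by
    apply mul_left_cancel₀ (pow_ne_zero (∑ i ∈ range k, (k - 1 - i)) (neg_ne_zero.2 one_ne_zero))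
    rw [mul_zero, ← h_alt, mul_sum]
    refine sum_congr rfl fun μ hμ => ?_
    simp only [mul_assoc, prod_mul_distrib,
      prod_neg_one_pow_shiftedRow (mem_boxDiagrams.1 hμ).1]
  rw [sum_filter_even_card, h_sum, hcard, add_zero]

lemma filter_shiftedRow_eq_zero (k : ℕ) (μ : YoungDiagram) :
    ({i ∈ range k | shiftedRow k μ i = 0} : Finset ℕ) = if μ.colLen 0 < k then {k - 1} else ∅ := by
  ext i
  have hrow : μ.rowLen i = 0 ↔ μ.colLen 0 ≤ i := rowLen_eq_zero_iff μ
  rw [mem_filter, shiftedRow]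
  split_ifs <;> simp only [mem_range, mem_singleton, notMem_empty, iff_false] <;> omega

lemma prod_halfAt_last (hk : 0 < k) (hμ : μ.rowLen 0 ≤ n) :
    ∏ i ∈ range k, halfAt (n + k - 1) (shiftedRow k μ i) =
      if μ.rowLen 0 < n then 1 else 1 / 2 := by
  obtain ⟨k, rfl⟩ := Nat.exists_eq_succ_of_ne_zero hk.ne'
  have hlt : ∀ i ∈ range k, halfAt (n + (k + 1) - 1) (shiftedRow (k + 1) μ (i + 1)) = 1 :=
    fun i hi => if_neg (by
      have hrow := μ.rowLen_anti 0 (i + 1) (Nat.zero_le _)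
      rw [mem_range] at hi
      rw [shiftedRow]
      omega)
  have hfirst : shiftedRow (k + 1) μ 0 = n + (k + 1) - 1 ↔ ¬ μ.rowLen 0 < n := by
    rw [shiftedRow]
    omega
  rw [Nat.succ_eq_add_one, prod_range_succ', prod_congr rfl hlt, prod_const_one, one_mul, halfAt]
  simp only [hfirst, ite_not]

lemma transpose_mem_boxDiagrams {h w : ℕ} (hμ : μ ∈ boxDiagrams h w) :
    μ.transpose ∈ boxDiagrams w h := by
  rw [mem_boxDiagrams] at hμ ⊢
  rw [YoungDiagram.colLen_transpose, YoungDiagram.rowLen_transpose]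
  exact hμ.symm

lemma sum_boxDiagrams_transpose (h w : ℕ) (F : YoungDiagram → ℝ) :
    ∑ μ ∈ boxDiagrams h w, F μ = ∑ μ ∈ boxDiagrams w h, F μ.transpose :=
  sum_nbij' YoungDiagram.transpose YoungDiagram.transpose (fun _ => transpose_mem_boxDiagrams)
    (fun _ => transpose_mem_boxDiagrams) (fun μ _ => μ.transpose_transpose)
    (fun μ _ => μ.transpose_transpose) fun μ _ => by rw [YoungDiagram.transpose_transpose]

end EvenDiagrams

lemma sinSq_hook_ne_zero {ℓ T w : ℕ} {μ : YoungDiagram} (hℓ : T + w ≤ ℓ)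
    (hμ : μ ∈ colDiagrams T w) : ∀ c ∈ μ.cells, sinSq ℓ (hook μ c) ≠ 0 := fun c hc => by
  have hμ := mem_colDiagrams.1 hμ
  have hlt := hook_lt μ c
  exact sinSq_ne_zero (hook_pos hc) (by omega)

lemma gWeight_flipCol {ℓ T w : ℕ} {μ : YoungDiagram} (hw : 0 < w) (hℓ : T + w ≤ ℓ)
    (hμ : μ ∈ colDiagrams T w) :
    gWeight (sinSq ℓ) T (flipCol T μ) = gWeight (sinSq ℓ) T μ :=
  gWeight_flip (fun j => (colLen_flipCol_succ T μ j)) (colLen_zero_add_colLen_flipCol hμ)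
    (sinSq_hook_ne_zero hℓ hμ) (sinSq_hook_ne_zero hℓ (flipCol_mem hw hμ))

lemma pairProd_two_reflect {ℓ k : ℕ} {p q : ℕ → ℕ} (h_zero : p 0 + q 0 + 2 = ℓ)
    (h_succ : ∀ i, q (i + 1) = p (i + 1)) :
    pairProd (sinSq ℓ) k 2 q * ∏ i ∈ range k, sinSq ℓ (q i + 1) =
      pairProd (sinSq ℓ) k 2 p * ∏ i ∈ range k, sinSq ℓ (p i + 1) := by
  have hsymm {m n : ℤ} (hmn : m + n = ℓ) : sinSq ℓ n = sinSq ℓ m := by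
    rw [← sinSq_natCast_sub (by omega), ← hmn, add_sub_cancel_right]
  rw [pairProd, pairProd]
  congr 1 <;> refine prod_congr rfl fun i _ => ?_
  · refine prod_congr rfl fun j hj => ?_
    obtain ⟨j, rfl⟩ := Nat.exists_eq_succ_of_ne_zero (by rw [mem_Ico] at hj; omega : j ≠ 0)
    rw [Nat.succ_eq_add_one, h_succ]
    rcases i with _ | i
    · rw [mul_comm]
      congr 1 <;> exact hsymm (by omega)
    · rw [h_succ]
  · rcases i with _ | i
    · exact hsymm (by omega)
    · rw [h_succ]

section WeightSums

variable {ℓ k n : ℕ} {μ : YoungDiagram}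

lemma sum_gWeight_odd (hn : 0 < n) (hℓ : ℓ = 2 * (n + k) + 1) :
    (∑ μ ∈ colDiagrams (2 * k + 1) n with Even μ.card, gWeight (sinSq ℓ) (2 * k + 1) μ) *
      (pairProd (sinSq ℓ) k 2 (k - 1 - ·) * ∏ i ∈ range k, sinSq ℓ ((k - 1 - i : ℕ) + 1)) =
        (ℓ : ℝ) ^ k := by
  have hflip : ∀ μ ∈ colDiagrams (2 * k + 1) n, gWeight (sinSq ℓ) (2 * k + 1)
      (flipCol (2 * k + 1) μ) = gWeight (sinSq ℓ) (2 * k + 1) μ := fun μ hμ => by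
    exact_mod_cast gWeight_flipCol hn (by omega) hμ
  rw [sum_colDiagrams_odd hn hflip, sum_mul, ← sum_boxDiagrams_odd_one hℓ]
  refine sum_congr rfl fun μ hμ => ?_
  rw [← filter_colLen_le_colDiagrams (Nat.le_succ (2 * k)), mem_filter] at hμ
  exact gWeight_odd (sinSq_neg ℓ) (sinSq_hook_ne_zero (by omega) hμ.1) hμ.2

lemma sinSq_two_mul (ℓ x : ℕ) :
    sinSq ℓ (2 * x) = sinSq ℓ x * (2 * cos (halfAngle ℓ 0 x)) ^ 2 := by
  have hdouble : ((2 * x : ℤ) : ℝ) * π / ℓ = 2 * (x * π / ℓ) := by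
    push_cast
    ring
  have hangle : halfAngle ℓ 0 x = x * π / ℓ := by
    rw [halfAngle, Int.cast_zero, add_zero, mul_assoc, mul_div_mul_left _ _ two_ne_zero]
  rw [sinSq, sinSq, hdouble, hangle, sin_two_mul, Int.cast_natCast]
  ring

lemma prod_halfAt_mul_cos_sq (ℓ k : ℕ) (μ : YoungDiagram) :
    ∏ i ∈ range k, halfAt 0 (shiftedRow k μ i) *
        (2 * cos (halfAngle ℓ 0 (shiftedRow k μ i))) ^ 2 =
      (if μ.colLen 0 < k then 2 else 1) *
        ∏ i ∈ range k with shiftedRow k μ i ≠ 0,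
          (2 * cos (halfAngle ℓ 0 (shiftedRow k μ i))) ^ 2 := by
  have hzero : ∏ i ∈ range k with shiftedRow k μ i = 0, halfAt 0 (shiftedRow k μ i) *
      (2 * cos (halfAngle ℓ 0 (shiftedRow k μ i))) ^ 2 = if μ.colLen 0 < k then 2 else 1 := by
    have htwo : halfAt 0 0 * (2 * cos (halfAngle ℓ 0 0)) ^ 2 = 2 := by
      norm_num [halfAt, halfAngle]
    rw [prod_congr rfl fun i hi => by rw [(mem_filter.1 hi).2, htwo],
      filter_shiftedRow_eq_zero]
    split_ifs <;> simp
  have hpos : ∀ i ∈ {i ∈ range k | shiftedRow k μ i ≠ 0}, halfAt 0 (shiftedRow k μ i) *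
      (2 * cos (halfAngle ℓ 0 (shiftedRow k μ i))) ^ 2 =
        (2 * cos (halfAngle ℓ 0 (shiftedRow k μ i))) ^ 2 := fun i hi => by
    rw [halfAt, if_neg (mem_filter.1 hi).2, one_mul]
  rw [← prod_filter_mul_prod_filter_not _ fun i => shiftedRow k μ i = 0, hzero, prod_congr rfl hpos]

lemma gWeight_even_sinSq (hℓ : ℓ = 2 * (n + k)) (hcol : μ ∈ boxDiagrams k n) :
    (if μ.colLen 0 < k then 2 else 1) * gWeight (sinSq ℓ) (2 * k) μ *
        pairProd (sinSq ℓ) k 1 (k - 1 - ·) =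
      (∏ i ∈ range k, halfAt 0 (shiftedRow k μ i) *
        (2 * cos (halfAngle ℓ 0 (shiftedRow k μ i))) ^ 2) *
          pairProd (sinSq ℓ) k 0 (shiftedRow k μ) := by
  have hne : ∏ i ∈ range k with shiftedRow k μ i ≠ 0, sinSq ℓ (shiftedRow k μ i) ≠ 0 :=
    prod_ne_zero_iff.2 fun i hi => by
      rw [mem_filter, mem_range] at hi
      have hlt := shiftedRow_lt hcol hi.1
      exact sinSq_ne_zero (by omega) (by omega)
  rw [← filter_colLen_le_colDiagrams le_rfl, mem_filter] at hcol
  have hweyl := gWeight_even (sinSq_neg ℓ) (sinSq_hook_ne_zero (by omega) hcol.1) hcol.2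
  simp only [sinSq_two_mul, prod_mul_distrib (f := fun _ => sinSq _ _)] at hweyl
  rw [prod_halfAt_mul_cos_sq]
  apply mul_right_cancel₀ hne
  linear_combination (if μ.colLen 0 < k then 2 else 1) * hweyl

lemma sum_gWeight_even (hk : 0 < k) (hn : 0 < n) (hℓ : ℓ = 2 * (n + k)) :
    (∑ μ ∈ colDiagrams (2 * k) n with Even μ.card, gWeight (sinSq ℓ) (2 * k) μ) *
      pairProd (sinSq ℓ) k 1 (k - 1 - ·) = (ℓ : ℝ) ^ k / 2 := by
  have hflip : ∀ μ ∈ colDiagrams (2 * k) n, gWeight (sinSq ℓ) (2 * k) (flipCol (2 * k) μ) =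
      gWeight (sinSq ℓ) (2 * k) μ := fun μ hμ => by
    exact_mod_cast gWeight_flipCol hn (by omega) hμ
  have hsum := sum_boxDiagrams_even_card (ω := halfAt 0)
    (U := fun x => (2 * cos (halfAngle ℓ 0 x)) ^ 2) (sum_boxDiagrams_even_zero hn hℓ)
    (sum_boxDiagrams_even_zero_alternating hk hn hℓ)
  rw [sum_colDiagrams_even hn hflip, sum_mul, ← hsum]
  exact sum_congr rfl fun μ hμ => gWeight_even_sinSq hℓ (mem_filter.1 hμ).1

lemma gWeight_neg_sinSq {T : ℕ} (hℓ : ℓ = 2 * k + T) (hμ : μ.transpose ∈ colDiagrams T k) :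
    gWeight (sinSq ℓ) (-(2 * k)) μ.transpose * (pairProd (sinSq ℓ) k 1 (k - 1 - ·) *
        ∏ i ∈ range k, sinSq ℓ (2 * (k - 1 - i : ℕ) + 1)) =
      pairProd (sinSq ℓ) k 2 (shiftedRow k μ) * ∏ i ∈ range k, sinSq ℓ (shiftedRow k μ i + 1) := by
  have hweyl := gWeight_neg (sinSq_neg ℓ) (sinSq_hook_ne_zero (by omega) hμ)
    (mem_colDiagrams.1 hμ).2
  rwa [YoungDiagram.transpose_transpose] at hweyl

lemma gWeight_neg_flipCol {T : ℕ} (hk : 0 < k) (hℓ : ℓ = 2 * k + T)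
    (hweyl : pairProd (sinSq ℓ) k 1 (k - 1 - ·) *
      ∏ i ∈ range k, sinSq ℓ (2 * (k - 1 - i : ℕ) + 1) ≠ 0) (hμ : μ ∈ colDiagrams T k) :
    gWeight (sinSq ℓ) (-(2 * k)) (flipCol T μ) = gWeight (sinSq ℓ) (-(2 * k)) μ := by
  apply mul_right_cancel₀ hweyl
  have hsum := colLen_zero_add_colLen_flipCol hμ
  have hweight := gWeight_neg_sinSq (μ := μ.transpose) hℓ
    (by rwa [YoungDiagram.transpose_transpose])
  have hweight_flip := gWeight_neg_sinSq (μ := (flipCol T μ).transpose) hℓ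
    (by rw [YoungDiagram.transpose_transpose]; exact flipCol_mem hk hμ)
  rw [YoungDiagram.transpose_transpose] at hweight hweight_flip
  rw [hweight_flip, hweight]
  refine pairProd_two_reflect ?_ fun i => ?_ <;>
    simp only [shiftedRow, YoungDiagram.rowLen_transpose, colLen_flipCol_succ]
  omega

/-- For even `T` the weights `1/2` in the box sum account for the diagrams on which
`flipCol T` changes the first column. -/
lemma sum_gWeight_neg_of_even {h : ℕ} (hk : 0 < k) (hh : 0 < h) (hℓ : ℓ = 2 * k + 2 * h)
    (hweyl : pairProd (sinSq ℓ) k 1 (k - 1 - ·) *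
      ∏ i ∈ range k, sinSq ℓ (2 * (k - 1 - i : ℕ) + 1) ≠ 0) :
    (∑ μ ∈ colDiagrams (2 * h) k with Even μ.card, gWeight (sinSq ℓ) (-(2 * k)) μ) *
      (pairProd (sinSq ℓ) k 1 (k - 1 - ·) *
        ∏ i ∈ range k, sinSq ℓ (2 * (k - 1 - i : ℕ) + 1)) = (ℓ : ℝ) ^ k := by
  have hsum := sum_boxDiagrams_even_card (ω := halfAt (h + k - 1))
    (U := fun x => sinSq ℓ (x + 1)) (sum_boxDiagrams_even_two hh (by omega))
    (sum_boxDiagrams_even_two_alternating hk hh (by omega))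
  rw [sum_colDiagrams_even hk fun μ hμ => gWeight_neg_flipCol hk hℓ hweyl hμ, sum_filter,
    sum_boxDiagrams_transpose, ← sum_filter, ← mul_div_cancel₀ ((ℓ : ℝ) ^ k) two_ne_zero, ← hsum,
    sum_mul, mul_sum]
  simp only [card_transpose]
  refine sum_congr rfl fun μ hμ => ?_
  have hbox := (mem_filter.1 hμ).1
  have hcol := transpose_mem_boxDiagrams hbox
  rw [← filter_colLen_le_colDiagrams le_rfl, mem_filter] at hcol
  rw [mul_assoc, gWeight_neg_sinSq hℓ hcol.1, prod_mul_distrib,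
    prod_halfAt_last hk (mem_boxDiagrams.1 hbox).2, YoungDiagram.colLen_transpose]
  split_ifs <;> ring

lemma sum_gWeight_neg_of_odd {h : ℕ} (hk : 0 < k) (hℓ : ℓ = 2 * k + (2 * h + 1))
    (hweyl : pairProd (sinSq ℓ) k 1 (k - 1 - ·) *
      ∏ i ∈ range k, sinSq ℓ (2 * (k - 1 - i : ℕ) + 1) ≠ 0) :
    (∑ μ ∈ colDiagrams (2 * h + 1) k with Even μ.card, gWeight (sinSq ℓ) (-(2 * k)) μ) *
      (pairProd (sinSq ℓ) k 1 (k - 1 - ·) *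
        ∏ i ∈ range k, sinSq ℓ (2 * (k - 1 - i : ℕ) + 1)) = (ℓ : ℝ) ^ k := by
  rw [sum_colDiagrams_odd hk fun μ hμ => gWeight_neg_flipCol hk hℓ hweyl hμ,
    sum_boxDiagrams_transpose, sum_mul, ← sum_boxDiagrams_odd_two (n := h) (by omega)]
  refine sum_congr rfl fun μ hμ => gWeight_neg_sinSq hℓ ?_
  have hcol := transpose_mem_boxDiagrams hμ
  rw [← filter_colLen_le_colDiagrams (Nat.le_succ (2 * h)), mem_filter] at hcol
  exact hcol.1

lemma sum_gWeight_neg {T : ℕ} (hk : 0 < k) (hT : 0 < T) (hℓ : ℓ = 2 * k + T)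
    (hweyl : pairProd (sinSq ℓ) k 1 (k - 1 - ·) *
      ∏ i ∈ range k, sinSq ℓ (2 * (k - 1 - i : ℕ) + 1) ≠ 0) :
    (∑ μ ∈ colDiagrams T k with Even μ.card, gWeight (sinSq ℓ) (-(2 * k)) μ) *
      (pairProd (sinSq ℓ) k 1 (k - 1 - ·) *
        ∏ i ∈ range k, sinSq ℓ (2 * (k - 1 - i : ℕ) + 1)) = (ℓ : ℝ) ^ k := by
  obtain ⟨h, rfl | rfl⟩ := Nat.even_or_odd' T
  · exact sum_gWeight_neg_of_even hk (by omega) hℓ hweyl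
  · exact sum_gWeight_neg_of_odd hk hℓ hweyl

end WeightSums

section Roots

variable {k : ℕ}

/-- The vector `φ_i + s φ_j`, a root for `s = 1` and for `s = -1`. -/
noncomputable def pairRoot (x : (_ : Fin k) × Fin k) (s : ℝ) : Fin k → ℝ := phi x.1 + s • phi x.2

/-- The set of the roots `φ_i ± φ_j` with `i < j`. -/
noncomputable def pairRoots (k : ℕ) : Finset (Fin k → ℝ) :=
  (univ.sigma Ioi ×ˢ ({1, -1} : Finset ℝ)).image fun x => pairRoot x.1 x.2

/-- The set of the vectors `c φ_i`: the short roots for `c = 1`, the long roots for `c = 2`. -/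
noncomputable def axisRoots (k : ℕ) (c : ℝ) : Finset (Fin k → ℝ) :=
  univ.image fun i => c • phi i

lemma injOn_pairRoot : Set.InjOn (fun x : ((_ : Fin k) × Fin k) × ℝ => pairRoot x.1 x.2)
    (univ.sigma Ioi ×ˢ {1, -1} : Finset (((_ : Fin k) × Fin k) × ℝ)) := by
  rintro ⟨⟨i, j⟩, s⟩ hx ⟨⟨i', j'⟩, s'⟩ hx' heq
  simp only [mem_coe, mem_product, mem_sigma, mem_univ, mem_Ioi, true_and, mem_insert,
    mem_singleton] at hx hx'
  have hcoord (m : Fin k) := congrFun heq m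
  simp only [pairRoot, phi, Pi.add_apply, Pi.smul_apply, Pi.single_apply, smul_eq_mul] at hcoord
  have hi := hcoord i
  have hj := hcoord j
  have hi' := hcoord i'
  have hj' := hcoord j'
  grind

lemma pairRoot_notMem_axisRoots {x : (_ : Fin k) × Fin k} {s c : ℝ} (hx : x.1 < x.2) (hs : s ≠ 0) :
    pairRoot x s ∉ axisRoots k c := by
  intro hmem
  obtain ⟨m, -, heq⟩ := mem_image.1 hmem
  have h1 := congrFun heq x.1
  have h2 := congrFun heq x.2
  simp only [pairRoot, phi, Pi.add_apply, Pi.smul_apply, Pi.single_apply, smul_eq_mul] at h1 h2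
  grind

lemma disjoint_pairRoots_axisRoots (c : ℝ) : Disjoint (pairRoots k) (axisRoots k c) := by
  rw [pairRoots, disjoint_left, forall_mem_image]
  intro x hx
  simp only [mem_product, mem_sigma, mem_univ, mem_Ioi, true_and, mem_insert, mem_singleton] at hx
  exact pairRoot_notMem_axisRoots hx.1 (by rcases hx.2 with hs | hs <;> simp [hs])

lemma injective_smul_phi {c : ℝ} (hc : c ≠ 0) :
    Function.Injective fun i : Fin k => c • phi i := fun i j h => by
  have hi := congrFun h i
  simp only [phi, Pi.smul_apply, Pi.single_apply, smul_eq_mul] at hi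
  grind

lemma mem_pairRoots {α : Fin k → ℝ} :
    α ∈ pairRoots k ↔ ∃ i j, i < j ∧ (α = phi i - phi j ∨ α = phi i + phi j) := by
  simp only [pairRoots, pairRoot, mem_image, mem_product, mem_sigma, mem_univ, mem_Ioi, true_and,
    mem_insert, mem_singleton, Prod.exists, Sigma.exists]
  refine exists_congr fun i => exists_congr fun j => ?_
  simp only [and_assoc, exists_and_left, or_and_right, exists_or, exists_eq_left, one_smul,
    neg_smul, ← sub_eq_add_neg, eq_comm (a := α)]
  rw [or_comm]

lemma mem_axisRoots {c : ℝ} {α : Fin k → ℝ} : α ∈ axisRoots k c ↔ ∃ i, α = c • phi i := by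
  simp only [axisRoots, mem_image, mem_univ, true_and, eq_comm]

lemma posRoots_finite (N : ℤ) : (posRoots N).Finite := by
  refine ((pairRoots (rk N) ∪ (axisRoots (rk N) 1 ∪ axisRoots (rk N) 2)).finite_toSet).subset ?_
  rintro α (hα | ⟨-, -, hα⟩ | ⟨-, -, hα⟩)
  · exact mem_union_left _ (mem_pairRoots.2 hα)
  · exact mem_union_right _ (mem_union_left _ (mem_axisRoots.2 (by simpa only [one_smul])))
  · exact mem_union_right _ (mem_union_right _ (mem_axisRoots.2 hα))

variable {N : ℤ}

lemma posRoots_of_pos_of_even (h0 : 0 < N) (heven : Even N) : posRoots N = pairRoots (rk N) := by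
  ext α
  simp [posRoots, mem_pairRoots, heven, h0.not_gt]

lemma posRoots_of_pos_of_odd (h0 : 0 < N) (hodd : Odd N) :
    posRoots N = ↑(pairRoots (rk N) ∪ axisRoots (rk N) 1) := by
  ext α
  simp [posRoots, mem_pairRoots, mem_axisRoots, h0, hodd, h0.not_gt]

lemma posRoots_of_neg (h0 : N < 0) (heven : Even N) :
    posRoots N = ↑(pairRoots (rk N) ∪ axisRoots (rk N) 2) := by
  ext α
  simp [posRoots, mem_pairRoots, mem_axisRoots, h0, heven, h0.not_gt]

/-- The factor `4 sin²((α, v)π/ℓ)` of the root `α`, where `v` will be the vector `ρ̌`. -/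
noncomputable def rootSinSq (ℓ : ℕ) (v α : Fin k → ℝ) : ℝ := 4 * sin ((α ⬝ᵥ v) * π / ℓ) ^ 2

lemma rootSinSq_of_dotProduct_eq {ℓ : ℕ} {v α : Fin k → ℝ} {m : ℤ} (h : α ⬝ᵥ v = m) :
    rootSinSq ℓ v α = sinSq ℓ m := by
  rw [rootSinSq, sinSq, h]

lemma pairRoot_dotProduct (x : (_ : Fin k) × Fin k) (s : ℝ) (v : Fin k → ℝ) :
    pairRoot x s ⬝ᵥ v = v x.1 + s * v x.2 := by
  rw [pairRoot, phi, phi, add_dotProduct, smul_dotProduct, single_one_dotProduct,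
    single_one_dotProduct, smul_eq_mul]

lemma prod_pairRoots {ℓ : ℕ} {δ : ℤ} {v : Fin k → ℝ}
    (hv : ∀ i : Fin k, v i = (k - 1 - i : ℕ) + δ / 2) :
    ∏ α ∈ pairRoots k, rootSinSq ℓ v α = pairProd (sinSq ℓ) k δ (k - 1 - ·) := by
  rw [pairRoots, prod_image injOn_pairRoot, prod_product, prod_sigma, pairProd,
    ← prod_univ_Ioi_eq k fun i j => sinSq ℓ ((k - 1 - i : ℕ) - (k - 1 - j : ℕ)) *
      sinSq ℓ ((k - 1 - i : ℕ) + (k - 1 - j : ℕ) + δ)]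
  refine prod_congr rfl fun i _ => prod_congr rfl fun j _ => ?_
  rw [prod_pair (by norm_num), mul_comm]
  congr 1 <;>
  · apply rootSinSq_of_dotProduct_eq
    rw [pairRoot_dotProduct, hv, hv]
    push_cast
    ring

lemma prod_axisRoots {ℓ : ℕ} {c : ℝ} (hc : c ≠ 0) {v : Fin k → ℝ} {m : ℕ → ℤ}
    (hv : ∀ i : Fin k, c * v i = m i) :
    ∏ α ∈ axisRoots k c, rootSinSq ℓ v α = ∏ i ∈ range k, sinSq ℓ (m i) := by
  rw [axisRoots, prod_image (injective_smul_phi hc).injOn,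
    ← Fin.prod_univ_eq_prod_range fun i => sinSq ℓ (m i)]
  refine prod_congr rfl fun i _ => rootSinSq_of_dotProduct_eq ?_
  rw [smul_dotProduct, phi, single_one_dotProduct, smul_eq_mul, hv]

end Roots

section Weights

variable {N : ℤ} {ℓ : ℕ} {q : ℂ}

lemma zpow_sub_zpow_neg_sq (hq : q ^ 2 = Complex.exp (2 * π * Complex.I / ℓ) ∨
      q ^ 2 = Complex.exp (-(2 * π * Complex.I / ℓ))) (n : ℤ) :
    (q ^ n - q ^ (-n)) ^ 2 = -(sinSq ℓ n : ℂ) := by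
  have hq0 : q ≠ 0 := by
    rintro rfl
    rcases hq with h | h <;> exact Complex.exp_ne_zero _ (by rw [← h, zero_pow two_ne_zero])
  have hexp : (q ^ 2) ^ n + (q ^ 2) ^ (-n) = 2 * Complex.cos (2 * (n * π / ℓ)) := by
    rw [Complex.two_cos]
    rcases hq with h | h <;> rw [h, ← Complex.exp_int_mul, ← Complex.exp_int_mul]
    · push_cast
      congr 2 <;> ring
    · rw [add_comm]
      push_cast
      congr 2 <;> ring
  have hinv : q ^ n * q ^ (-n) = 1 := by rw [← zpow_add₀ hq0, add_neg_cancel, zpow_zero]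
  have hsq (m : ℤ) : (q ^ 2) ^ m = (q ^ m) ^ 2 := by rw [← zpow_natCast, ← zpow_natCast, zpow_comm]
  rw [hsq, hsq, Complex.cos_two_mul] at hexp
  rw [sinSq]
  push_cast
  linear_combination hexp - 2 * hinv + 4 * Complex.sin_sq_add_cos_sq ((n : ℂ) * π / ℓ)

lemma dWeight_sq (hℓ : 1 < ℓ) (hq : q ^ 2 = Complex.exp (2 * π * Complex.I / ℓ) ∨
      q ^ 2 = Complex.exp (-(2 * π * Complex.I / ℓ))) (N : ℤ) (μ : YoungDiagram) :
    dWeight N q μ ^ 2 = (gWeight (sinSq ℓ) N μ : ℂ) := by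
  have hdenom : (q - q⁻¹) ^ 2 = -(sinSq ℓ 1 : ℂ) := by
    simpa only [zpow_one, zpow_neg_one] using zpow_sub_zpow_neg_sq hq 1
  have hne : (sinSq ℓ 1 : ℂ) ≠ 0 := by
    exact_mod_cast sinSq_ne_zero one_pos (by exact_mod_cast hℓ)
  rw [dWeight, gWeight, ← prod_pow, Complex.ofReal_prod]
  refine prod_congr rfl fun c _ => ?_
  rw [div_pow, qNum, qNum, div_pow, div_pow, zpow_sub_zpow_neg_sq hq, zpow_sub_zpow_neg_sq hq,
    hdenom, neg_div_neg_eq, neg_div_neg_eq, div_div_div_cancel_right₀ hne, Complex.ofReal_div]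

lemma finsum_dWeight_sq (hℓ : 1 < ℓ) (hq : q ^ 2 = Complex.exp (2 * π * Complex.I / ℓ) ∨
      q ^ 2 = Complex.exp (-(2 * π * Complex.I / ℓ))) (N : ℤ) {S : Set YoungDiagram}
    (hS : S.Finite) :
    ∑ᶠ μ ∈ S, dWeight N q μ ^ 2 = ((∑ᶠ μ ∈ S, gWeight (sinSq ℓ) N μ : ℝ) : ℂ) := by
  simp only [dWeight_sq hℓ hq]
  exact (Complex.ofRealHom.toAddMonoidHom.map_finsum_mem _ hS).symm

lemma evenDiagrams_of_pos {T w : ℕ} (h0 : 0 < N) (hT : N = T) (hw : (ℓ : ℤ) - N = 2 * w) :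
    evenDiagrams N ℓ = {μ ∈ colDiagrams T w | Even μ.card} := by
  ext μ
  rw [coe_filter, Set.mem_ofPred_eq, mem_colDiagrams]
  simp only [evenDiagrams, diagrams, Set.mem_ofPred_eq, if_pos h0, hw, even_two_mul, if_true]
  refine and_congr_left fun _ => ?_
  omega

lemma evenDiagrams_of_neg {T k : ℕ} (h0 : N < 0) (hk : N = -(2 * k)) (hT : (ℓ : ℤ) = 2 * k + T) :
    evenDiagrams N ℓ = {μ ∈ colDiagrams T k | Even μ.card} := by
  ext μ
  rw [coe_filter, Set.mem_ofPred_eq, mem_colDiagrams]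
  have heven : Even N := hk ▸ (even_two_mul _).neg
  simp only [evenDiagrams, diagrams, Set.mem_ofPred_eq, if_neg h0.not_gt, if_pos heven,
    abs_of_neg h0]
  refine and_congr_left fun _ => ?_
  omega

lemma evenDiagrams_finite (hℓ : |N| < (ℓ : ℤ))
    (hcase : (0 < N ∧ Even ((ℓ : ℤ) - N)) ∨ (N < 0 ∧ Even N)) : (evenDiagrams N ℓ).Finite := by
  obtain ⟨h0, w, hw⟩ | ⟨h0, k, hk⟩ := hcase
  · rw [abs_of_pos h0] at hℓ
    lift N to ℕ using h0.le
    lift w to ℕ using (by omega)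
    rw [evenDiagrams_of_pos (w := w) h0 rfl (by omega)]
    exact finite_toSet _
  · rw [abs_of_neg h0] at hℓ
    obtain ⟨m, hm⟩ := Int.eq_ofNat_of_zero_le (show 0 ≤ -k by omega)
    obtain ⟨T, hT⟩ := Int.eq_ofNat_of_zero_le (show 0 ≤ (ℓ : ℤ) + N by omega)
    rw [evenDiagrams_of_neg (k := m) (T := T) h0 (by omega) (by omega)]
    exact finite_toSet _

end Weights

section Cases

variable {N : ℤ} {ℓ : ℕ}

lemma bConst_ne_zero (N : ℤ) : (bConst N : ℝ) ≠ 0 := by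
  rw [bConst]
  split_ifs <;> norm_num

lemma rhoCheck_apply {δ : ℤ} (hδ : |N| = 2 * rk N - 1 + δ) (i : Fin (rk N)) :
    rhoCheck N i = (rk N - 1 - i : ℕ) + δ / 2 := by
  have hcast : (|(N : ℝ)|) = 2 * rk N - 1 + δ := by exact_mod_cast hδ
  have hi : i + 1 ≤ rk N := i.2
  rw [rhoCheck, hcast, Nat.sub_sub, Nat.cast_sub (by omega)]
  push_cast
  ring

lemma finsum_gWeight_mul_of_pos_of_odd (h0 : 0 < N) (hodd : Odd N) (hℓ : N < ℓ)
    (hparity : Even ((ℓ : ℤ) - N)) :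
    (∑ᶠ μ ∈ evenDiagrams N ℓ, gWeight (sinSq ℓ) N μ) *
      ∏ᶠ α ∈ posRoots N, rootSinSq ℓ (rhoCheck N) α = (ℓ : ℝ) ^ rk N / bConst N := by
  have hN : N = 2 * rk N + 1 := by
    obtain ⟨t, ht⟩ := hodd
    rw [rk]
    omega
  have hρ := rhoCheck_apply (N := N) (δ := 2) (by rw [abs_of_pos h0]; omega)
  obtain ⟨w, hw⟩ := hparity
  lift w to ℕ using (by omega)
  have hsum := sum_gWeight_odd (k := rk N) (n := w) (ℓ := ℓ) (by omega) (by omega)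
  rw [← hN] at hsum
  rw [evenDiagrams_of_pos (T := 2 * rk N + 1) (w := w) h0 (by exact_mod_cast hN) (by omega),
    posRoots_of_pos_of_odd h0 hodd, finsum_mem_coe_finset, finprod_mem_coe_finset,
    prod_union (disjoint_pairRoots_axisRoots 1), prod_pairRoots hρ,
    prod_axisRoots one_ne_zero (m := fun i => (rk N - 1 - i : ℕ) + 1), hsum, bConst,
    if_neg fun h => Int.not_even_iff_odd.2 hodd h.2, Nat.cast_one, div_one]
  intro i
  rw [hρ]
  push_cast
  ring

lemma finsum_gWeight_mul_of_pos_of_even (h0 : 0 < N) (heven : Even N) (hℓ : N < ℓ)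
    (hparity : Even ((ℓ : ℤ) - N)) :
    (∑ᶠ μ ∈ evenDiagrams N ℓ, gWeight (sinSq ℓ) N μ) *
      ∏ᶠ α ∈ posRoots N, rootSinSq ℓ (rhoCheck N) α = (ℓ : ℝ) ^ rk N / bConst N := by
  have hN : N = 2 * rk N := by
    obtain ⟨t, ht⟩ := heven
    rw [rk]
    omega
  have hρ := rhoCheck_apply (N := N) (δ := 1) (by rw [abs_of_pos h0]; omega)
  obtain ⟨w, hw⟩ := hparity
  lift w to ℕ using (by omega)
  have hsum := sum_gWeight_even (k := rk N) (n := w) (ℓ := ℓ) (by omega) (by omega) (by omega)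
  rw [← hN] at hsum
  rw [evenDiagrams_of_pos (T := 2 * rk N) (w := w) h0 (by exact_mod_cast hN) (by omega),
    posRoots_of_pos_of_even h0 heven, finsum_mem_coe_finset, finprod_mem_coe_finset,
    prod_pairRoots hρ, hsum, bConst, if_pos ⟨h0, heven⟩, Nat.cast_two]

lemma pairProd_sinSq_ne_zero {k : ℕ} (hkℓ : 2 * k ≤ ℓ) :
    pairProd (sinSq ℓ) k 1 (k - 1 - ·) ≠ 0 := by
  refine prod_ne_zero_iff.2 fun i hi => prod_ne_zero_iff.2 fun j hj => ?_
  rw [mem_range] at hi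
  rw [mem_Ico] at hj
  beta_reduce
  exact mul_ne_zero (sinSq_ne_zero (by omega) (by omega)) (sinSq_ne_zero (by omega) (by omega))

lemma finsum_gWeight_mul_of_neg (h0 : N < 0) (heven : Even N) (hℓ : -N < ℓ) :
    (∑ᶠ μ ∈ evenDiagrams N ℓ, gWeight (sinSq ℓ) N μ) *
      ∏ᶠ α ∈ posRoots N, rootSinSq ℓ (rhoCheck N) α = (ℓ : ℝ) ^ rk N / bConst N := by
  have hN : N = -(2 * rk N) := by
    obtain ⟨t, ht⟩ := heven
    rw [rk]
    omega
  have hρ := rhoCheck_apply (N := N) (δ := 1) (by rw [abs_of_neg h0]; omega)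
  obtain ⟨T, hT⟩ := Int.eq_ofNat_of_zero_le (show 0 ≤ (ℓ : ℤ) + N by omega)
  have hlong : ∏ i ∈ range (rk N), sinSq ℓ (2 * (rk N - 1 - i : ℕ) + 1) ≠ 0 :=
    prod_ne_zero_iff.2 fun i hi => sinSq_ne_zero (by omega) (by rw [mem_range] at hi; omega)
  have hsum := sum_gWeight_neg (k := rk N) (T := T) (ℓ := ℓ) (by omega) (by omega) (by omega)
    (mul_ne_zero (pairProd_sinSq_ne_zero (by omega)) hlong)
  rw [← hN] at hsum
  rw [evenDiagrams_of_neg (T := T) (k := rk N) h0 hN (by omega), posRoots_of_neg h0 heven,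
    finsum_mem_coe_finset, finprod_mem_coe_finset, prod_union (disjoint_pairRoots_axisRoots 2),
    prod_pairRoots hρ, prod_axisRoots two_ne_zero (m := fun i => 2 * (rk N - 1 - i : ℕ) + 1), hsum,
    bConst, if_neg fun h => h0.not_gt h.1, Nat.cast_one, div_one]
  intro i
  rw [hρ]
  push_cast
  ring

lemma finsum_gWeight_mul_finprod_rootSinSq (hℓ : |N| < (ℓ : ℤ))
    (hcase : (0 < N ∧ Even ((ℓ : ℤ) - N)) ∨ (N < 0 ∧ Even N)) :
    (∑ᶠ μ ∈ evenDiagrams N ℓ, gWeight (sinSq ℓ) N μ) *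
      ∏ᶠ α ∈ posRoots N, rootSinSq ℓ (rhoCheck N) α = (ℓ : ℝ) ^ rk N / bConst N := by
  obtain ⟨h0, hparity⟩ | ⟨h0, heven⟩ := hcase
  · rw [abs_of_pos h0] at hℓ
    rcases Int.even_or_odd N with heven | hodd
    · exact finsum_gWeight_mul_of_pos_of_even h0 heven hℓ hparity
    · exact finsum_gWeight_mul_of_pos_of_odd h0 hodd hℓ hparity
  · exact finsum_gWeight_mul_of_neg h0 heven (by rwa [abs_of_neg h0] at hℓ)

end Cases

end SquareSum

theorem proposition3p3 (N : ℤ) (ℓ : ℕ) (hN : 1 < |N|) (hℓ : |N| < (ℓ : ℤ))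
    (hcase : (0 < N ∧ Even ((ℓ : ℤ) - N)) ∨ (N < 0 ∧ Even N))
    (q : ℂ) (hq : q ^ 2 = Complex.exp (2 * Real.pi * Complex.I / ℓ) ∨
      q ^ 2 = Complex.exp (-(2 * Real.pi * Complex.I / ℓ))) :
    (SquareSum.evenDiagrams N ℓ).Finite ∧ (SquareSum.posRoots N).Finite ∧
      ∑ᶠ μ ∈ SquareSum.evenDiagrams N ℓ, SquareSum.dWeight N q μ ^ 2 =
        (((ℓ : ℝ) ^ SquareSum.rk N / SquareSum.bConst N *
          ∏ᶠ α ∈ SquareSum.posRoots N,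
            1 / (4 * Real.sin ((α ⬝ᵥ SquareSum.rhoCheck N) * Real.pi / ℓ) ^ 2) : ℝ) : ℂ) := by
  have hdiagrams := SquareSum.evenDiagrams_finite hℓ hcase
  have hroots := SquareSum.posRoots_finite N
  have hsum := SquareSum.finsum_gWeight_mul_finprod_rootSinSq hℓ hcase
  have hprod := right_ne_zero_of_mul (hsum.trans_ne (div_ne_zero
    (pow_ne_zero _ (Nat.cast_ne_zero.2 (by omega))) (SquareSum.bConst_ne_zero N)))
  refine ⟨hdiagrams, hroots, ?_⟩
  rw [SquareSum.finsum_dWeight_sq (by omega) hq N hdiagrams, ← hsum, Complex.ofReal_inj]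
  simp only [one_div, finprod_mem_inv_distrib _ hroots]
  exact (mul_inv_cancel_right₀ hprod _).symm
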